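/- Let $\mathrm{li}_2(z)=-\int_0^z\frac{\log(1-t)}{t}\,dt$ for $z\in\mathbb C\setminus[1,\infty)$ and let $D(z)=\mathrm{Im}(\mathrm{li}_2(z))+\mathrm{Arg}(1-z)\ln|z|$ be the Bloch--Wigner dilogarithm. For $\eta\in(-\pi,\pi)$ define the potential functions $$f_1(\alpha;\eta)=\mathrm{li}_2\big(-e^{-2\alpha\sqrt{-1}}\big)-\alpha^2+\eta\alpha+\tfrac{\pi^2}{12},\qquad f_2(\alpha;\eta)=\mathrm{li}_2\big(-e^{-2\alpha\sqrt{-1}}\big)-\alpha^2-\eta\alpha+\tfrac{\pi^2}{12}.$$ (1) For $i=1,2$, for every $\eta\in(-\pi,\pi)$ and every $\alpha_i=x_i+\sqrt{-1}\,y_i\in\mathbb C$ with $-e^{-2\alpha_i\sqrt{-1}}\notin[1,\infty)$, the partial derivative of $\mathrm{Im} f_i$ with respect to $y_i$ exists and $$\mathrm{Im} f_i(\alpha_i;\eta)=D\big(-e^{-2\alpha_i\sqrt{-1}}\big)+y_i\,\frac{\partial}{\partial y_i}\mathrm{Im} f_i(\alpha_i;\eta).$$ (2) For $\eta\in(-\pi,\pi)$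 put $B=e^{\eta\sqrt{-1}}$ and $$z_1(\eta)=\frac{(2-B)+\sqrt{(2-B)^2-4}}{2},\qquad z_2(\eta)=\frac{(2-B^{-1})+\sqrt{(2-B^{-1})^2-4}}{2},$$ with the branches of the square roots that are continuous in $\eta$ and equal $\sqrt{-1}\sqrt3$ at $\eta=0$. There are continuous functions $\alpha_1,\alpha_2:(-\pi,\pi)\to\mathbb C$ with $z_i(\eta)=-e^{-2\alpha_i(\eta)\sqrt{-1}}$ and $\alpha_1(0)=\alpha_2(0)=\frac{\pi}{3}$; for any such functions, the point $\alpha_i(\eta)$ is a critical point of $f_i(\,\cdot\,;\eta)$. Let $\Sigma=(\mathbb R^2\setminus\mathbb Z^2)/\mathbb Z^2$ be the once-punctured torus, let $\varphi=LR=\begin{pmatrix}1&1\\0&1\end{pmatrix}\begin{pmatrix}1&0\\1&1\end{pmatrix}$, let $M_\varphi$ be its mapping torus and let $\mu_v$ be the meridian, i.e. the loop around the puncture of $\Sigma$. The manifold $M_\varphi$ has the layered ideal triangulation with two tetrahedra, which lie over the lattice parallelograms with vertices $(0,0),(1,0),(0,1),(1,1)$ and $(0,0),(1,0),(1,1),(2,1)$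 and are the diagonal exchanges $\{(1,-1),(1,0),(0,1)\}\to\{(1,0),(0,1),(1,1)\}\to\{(1,0),(1,1),(2,1)\}$ of slopes; the top of the first is glued to the bottom of the second by translations, and the bottom of the first to the top of the second by $\varphi$ and translations. For $\theta\in[0,2\pi)$, a cone manifold $M_{\varphi,\theta}$ is $M_\varphi$ with a hyperbolic cone structure of cone angle $\theta$ along $\mu_v$ for which this triangulation is geometric: both tetrahedra are ideal hyperbolic tetrahedra whose shape parameters have positive imaginary part, glued along their faces by isometries, such that the logarithmic holonomy around each edge is $2\pi\sqrt{-1}$ and the logarithmic holonomy of $\mu_v$, suitably oriented, is $\theta\sqrt{-1}$ (for $\theta=0$ this is the complete structure). $\mathrm{Vol}(M_{\varphi,\theta})$ is its hyperbolic volume. Then for every $\eta_v\in(-\pi,\pi)$, with $\theta_v=2|\eta_v|$, such a cone manifold $M_{\varphi,\theta_v}$ exists, and every such cone manifold satisfies $$\mathrm{Im}\Big(f_1(\alpha_1(\eta_v);\eta_v)+f_2(\alpha_2(\eta_v);\eta_v)\Big)=\mathrm{Vol}(M_{\varphi,\theta_v}).$$ -/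

import Mathlib

noncomputable section

/-! ### Dilogarithms and the potential functions -/

/-- The classical dilogarithm `li₂(z) = -∫₀^z log(1-t)/t dt` on `ℂ ∖ [1,∞)`; the integral is taken
along the straight segment `t = s z`, `0 ≤ s ≤ 1`, with the principal logarithm. -/
def dilog (z : ℂ) : ℂ :=
  -∫ s in (0 : ℝ)..1, Complex.log (1 - (s : ℂ) * z) / ((s : ℂ) * z) * z

/-- The Bloch–Wigner dilogarithm `D(z) = Im li₂(z) + Arg(1-z) ln|z|`. -/
def blochWigner (z : ℂ) : ℝ :=
  (dilog z).im + Complex.arg (1 - z) * Real.log ‖z‖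

/-- The potential function `f₁(α; η)`. -/
def potential₁ (η : ℝ) (α : ℂ) : ℂ :=
  dilog (-Complex.exp (-2 * α * Complex.I)) - α ^ 2 + η * α + (Real.pi : ℂ) ^ 2 / 12

/-- The potential function `f₂(α; η)`. -/
def potential₂ (η : ℝ) (α : ℂ) : ℂ :=
  dilog (-Complex.exp (-2 * α * Complex.I)) - α ^ 2 - η * α + (Real.pi : ℂ) ^ 2 / 12

/-! ### The critical points -/

/-- The root `((2 - B) + √((2 - B)² - 4)) / 2` of `z² - (2 - B) z + 1 = 0`, where
`√((2 - B)² - 4)` is written `i √(4 - (2 - B)²)` with the principal square root. For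
`B = e^{iη}`, `|η| < π`, the number `4 - (2 - B)² = B (4 - B)` stays off `(-∞, 0]`, so this is the
continuous branch of the square root whose value at `η = 0` is `i √3`
(so the root at `η = 0` is `e^{iπ/3}`). -/
def quadraticRoot (B : ℂ) : ℂ :=
  ((2 - B) + Complex.I * (4 - (2 - B) ^ 2) ^ (1 / 2 : ℂ)) / 2

/-- `z₁(η)`: the root for `B = e^{iη}`. -/
def shape₁ (η : ℝ) : ℂ := quadraticRoot (Complex.exp (η * Complex.I))

/-- `z₂(η)`: the root for `B⁻¹ = e^{-iη}`. -/
def shape₂ (η : ℝ) : ℂ := quadraticRoot (Complex.exp (-(η * Complex.I)))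

/-- `α` is the continuous function on `(-π, π)` defined by `z(η) = -e^{-2 α(η) i}` and
`α(0) = π/3`. -/
structure IsCriticalBranch (z : ℝ → ℂ) (α : ℝ → ℂ) : Prop where
  continuousOn : ContinuousOn α (Set.Ioo (-Real.pi) Real.pi)
  at_zero : α 0 = (Real.pi : ℂ) / 3
  eq_exp : ∀ η ∈ Set.Ioo (-Real.pi) Real.pi, z η = -Complex.exp (-2 * α η * Complex.I)

/-! ### Hyperbolic 3-space and ideal tetrahedra -/

/-- The upper half-space model of hyperbolic 3-space: pairs `(w, t)`, `w ∈ ℂ`, `t > 0`. -/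
abbrev HypSpace : Type := {p : ℂ × ℝ // 0 < p.2}

/-- The hyperbolic volume measure `dx dy dt / t³`. -/
def hypVolume : MeasureTheory.Measure HypSpace :=
  ((MeasureTheory.volume : MeasureTheory.Measure (ℂ × ℝ)).comap Subtype.val).withDensity
    (fun p => ENNReal.ofReal (1 / p.1.2 ^ 3))

/-- The positive definite Hermitian matrix of determinant one attached to a point of
hyperbolic space. In this model an element `g` of `GL₂(ℂ)` acts as the isometry
`P ↦ g P gᴴ / |det g|`, the point at infinity `[u : v]` of `ℂP¹ = ∂ℍ³` is the ray of the rank one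
matrix `(u, v)(u, v)ᴴ`, and geodesic convexity is linear convexity of cones. -/
def hermitianOf (p : HypSpace) : Matrix (Fin 2) (Fin 2) ℂ :=
  ((1 / p.1.2 : ℝ) : ℂ) •
    !![((‖p.1.1‖ ^ 2 + p.1.2 ^ 2 : ℝ) : ℂ), p.1.1; (starRingEnd ℂ) p.1.1, 1]

/-- Homogeneous coordinates of the ideal points `∞, 0, 1, z`. -/
def idealVertex (z : ℂ) : Fin 4 → Fin 2 → ℂ :=
  ![![1, 0], ![0, 1], ![1, 1], ![z, 1]]

/-- The ideal tetrahedron with vertices `∞, 0, 1, z`: the geodesic convex hull of its vertices. -/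
def idealTetrahedron (z : ℂ) : Set HypSpace :=
  {p | ∃ c : Fin 4 → ℝ, (∀ j, 0 ≤ c j) ∧
    hermitianOf p =
      ∑ j, (c j : ℂ) • Matrix.vecMulVec (idealVertex z j) (star (idealVertex z j))}

/-- The face opposite to the vertex number `k`. -/
def idealFace (z : ℂ) (k : Fin 4) : Set HypSpace :=
  {p | ∃ c : Fin 4 → ℝ, (∀ j, 0 ≤ c j) ∧ c k = 0 ∧
    hermitianOf p =
      ∑ j, (c j : ℂ) • Matrix.vecMulVec (idealVertex z j) (star (idealVertex z j))}

/-- The shape parameter of the edge joining the vertices `j ≠ k` of the tetrahedron `∞, 0, 1, z`: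
`z` for the edges `∞0`, `1z`; `z' = 1/(1-z)` for `∞1`, `0z`; `z'' = 1 - 1/z` for `∞z`, `01`. Its
argument is the dihedral angle. -/
def edgeParam (z : ℂ) (j k : Fin 4) : ℂ :=
  if (j, k) ∈ [((0 : Fin 4), (1 : Fin 4)), (1, 0), (2, 3), (3, 2)] then z
  else if (j, k) ∈ [((0 : Fin 4), (2 : Fin 4)), (2, 0), (1, 3), (3, 1)] then 1 / (1 - z)
  else 1 - 1 / z

/-! ### The layered ideal triangulation of the mapping torus of `φ = LR`

The once-punctured torus is `(ℝ² ∖ ℤ²)/ℤ²`, on which `SL₂(ℤ)` acts; its mapping torus is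
`(ℝ² ∖ ℤ²) × ℝ` modulo `(x, s) ↦ (x + n, s)`, `n ∈ ℤ²`, and `(x, s) ↦ (φ x, s + 1)`.
An ideal triangulation of the punctured torus is given by three slopes. The two diagonal exchanges
`{(1,-1),(1,0),(0,1)} → {(1,0),(0,1),(1,1)} → {(1,0),(1,1),(2,1)}` lead from a triangulation to its
image under `φ`. Each exchange is a tetrahedron that projects to a lattice parallelogram, one
diagonal (the old one) on the bottom and the other diagonal (the new one) on the top. Stacking the
two tetrahedra and closing up by `φ` gives the ideal triangulation of the mapping torus. -/

/-- The monodromy `φ = LR`. -/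
def monodromy : Matrix (Fin 2) (Fin 2) ℤ :=
  !![1, 1; 0, 1] * !![1, 0; 1, 1]

/-- The lattice points over which the vertices of the two tetrahedra lie. The vertices `0, 1` are
the ends of the top diagonal, the vertices `2, 3` those of the bottom diagonal; hence the faces
opposite to `2, 3` are the top faces and those opposite to `0, 1` are the bottom faces. -/
def latticeVertex : Fin 2 → Fin 4 → Fin 2 → ℤ :=
  ![![![0, 0], ![1, 1], ![0, 1], ![1, 0]],
    ![![0, 0], ![2, 1], ![1, 1], ![1, 0]]]

/-- The face of the first tetrahedron opposite to `k` is glued to the face of the second one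
opposite to `σ k`, by the map of vertices `σ`: top faces of the first tetrahedron are glued to
bottom faces of the second one by a translation, bottom faces of the first tetrahedron to top faces
of the second one by `φ` followed by a translation. -/
def FacePairing (k : Fin 4) (σ : Equiv.Perm (Fin 4)) : Prop :=
  (k ∈ ({2, 3} : Set (Fin 4)) ∧ σ k ∈ ({0, 1} : Set (Fin 4)) ∧
    ∃ n : Fin 2 → ℤ, ∀ j, j ≠ k → latticeVertex 1 (σ j) = latticeVertex 0 j + n) ∨
  (k ∈ ({0, 1} : Set (Fin 4)) ∧ σ k ∈ ({2, 3} : Set (Fin 4)) ∧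
    ∃ n : Fin 2 → ℤ, ∀ j, j ≠ k →
      latticeVertex 1 (σ j) = monodromy.mulVec (latticeVertex 0 j) + n)

/-- The slopes that make up the two edges of the triangulation of the mapping torus
(`φ (1,-1) = (1,0)`, `φ (1,0) = (2,1)` and `φ (0,1) = (1,1)`). -/
def edgeSlopes : Fin 2 → Finset (Fin 2 → ℤ) :=
  ![{![1, -1], ![1, 0], ![2, 1]}, {![0, 1], ![1, 1]}]

/-- The logarithmic holonomy of the edge `e` for shapes `z 0`, `z 1`: the sum of `log` of the shape
parameters of all edges of the two tetrahedra that are glued to `e`. -/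
def edgeHolonomy (z : Fin 2 → ℂ) (e : Fin 2) : ℂ :=
  ∑ i : Fin 2, ∑ j : Fin 4, ∑ k : Fin 4,
    if j < k ∧ (latticeVertex i k - latticeVertex i j ∈ edgeSlopes e ∨
        latticeVertex i j - latticeVertex i k ∈ edgeSlopes e)
    then Complex.log (edgeParam (z i) j k) else 0

/-- The meridian, the loop around the puncture of the fibre, as a closed curve on the triangulated
boundary torus. An entry `(ε, i, v, w)` says that the curve crosses the link of the vertex `v` of
the tetrahedron `i` and cuts off there the corner given by the edge `v w`, which it leaves
to its left if `ε = 1` and to its right if `ε = -1`. -/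
def meridian : List (ℤ × Fin 2 × Fin 4 × Fin 4) :=
  [(-1, 0, 0, 1), (-1, 1, 3, 1), (1, 0, 3, 2), (1, 1, 1, 2),
   (-1, 0, 1, 0), (-1, 1, 2, 0), (1, 0, 2, 3), (1, 1, 0, 3)]

/-- The logarithmic holonomy of the meridian: the signed sum of `log` of the shape parameters of
the corners that it cuts off. -/
def meridianHolonomy (z : Fin 2 → ℂ) : ℂ :=
  (meridian.map fun s =>
    (s.1 : ℂ) * Complex.log (edgeParam (z s.2.1) s.2.2.1 s.2.2.2)).sum

/-! ### Hyperbolic cone structures -/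

/-- A hyperbolic cone structure on the mapping torus of `φ = LR` with cone angle `θ` around the
meridian, made of geodesic ideal tetrahedra: positively oriented shapes of the two tetrahedra of
the layered triangulation for which the hyperbolic metric extends over the edges (the logarithmic
holonomy of each edge is `2πi`) and the meridian, with one of its two orientations, has logarithmic
holonomy `iθ` (for `θ = 0`: the complete structure). -/
structure ConeStructure (θ : ℝ) where
  shape : Fin 2 → ℂ
  shape_im_pos : ∀ i, 0 < (shape i).im
  edge_eq : ∀ e, edgeHolonomy shape e = 2 * Real.pi * Complex.I
  meridian_eq : meridianHolonomy shape = θ * Complex.I ∨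
    meridianHolonomy shape = -(θ * Complex.I)

namespace ConeStructure

variable {θ : ℝ}

/-- The disjoint union of the two ideal tetrahedra. -/
abbrev Pieces (S : ConeStructure θ) : Type :=
  Σ i : Fin 2, idealTetrahedron (S.shape i)

/-- A point `x` of a face of the first tetrahedron is glued to a point `y` of the second tetrahedron
if `y = g x`, where `g` is the orientation preserving isometry that realizes the pairing of the
vertices of the face. -/
inductive Glued (S : ConeStructure θ) : S.Pieces → S.Pieces → Prop
  | mk (k : Fin 4) (σ : Equiv.Perm (Fin 4)) (g : GL (Fin 2) ℂ)
      (x : idealTetrahedron (S.shape 0)) (y : idealTetrahedron (S.shape 1))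
      (pairing : FacePairing k σ)
      (mem_face : (x : HypSpace) ∈ idealFace (S.shape 0) k)
      (vertices : ∀ j, j ≠ k → ∃ c : ℂ, c ≠ 0 ∧
        g.val.mulVec (idealVertex (S.shape 0) j) = c • idealVertex (S.shape 1) (σ j))
      (image : ((‖g.val.det‖ : ℝ) : ℂ) • hermitianOf y =
        g.val * hermitianOf x * g.val.conjTranspose) :
      Glued S ⟨0, x⟩ ⟨1, y⟩

/-- The cone manifold without its singular locus (a set of volume zero): the two ideal tetrahedra
glued along their faces by isometries. -/
def Manifold (S : ConeStructure θ) : Type := Quot S.Glued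

instance (S : ConeStructure θ) : MeasurableSpace S.Manifold :=
  inferInstanceAs (MeasurableSpace (Quot S.Glued))

/-- The hyperbolic volume measure on the disjoint union of the two tetrahedra. -/
def piecesVolume (S : ConeStructure θ) : MeasureTheory.Measure S.Pieces :=
  MeasureTheory.Measure.sum fun i =>
    (hypVolume.comap (Subtype.val : idealTetrahedron (S.shape i) → HypSpace)).map
      (fun x => (⟨i, x⟩ : S.Pieces))

/-- The hyperbolic volume measure on the cone manifold. As only faces (sets of volume zero) are
identified, it is the image of the volume of the pieces. -/
def volumeMeasure (S : ConeStructure θ) : MeasureTheory.Measure S.Manifold :=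
  S.piecesVolume.map (fun x => (Quot.mk S.Glued x : S.Manifold))

/-- The hyperbolic volume of the cone manifold. -/
def volume (S : ConeStructure θ) : ℝ := (S.volumeMeasure Set.univ).toReal

end ConeStructure

end

/-! Both sides equal `D(z₁) + D(z₂)`, where `D` is the Bloch–Wigner function.

Analytic side. Since `li₂' = -log (1 - z) / z`, one has `f₁' = 2i log (1 - z) - 2α + η` with `z =
-e^{-2αi}`. The `y`-derivative of `Im f₁` is `Re f₁'`, and `ln|z| = 2y`; so (1) is an algebraic
identity, and at a critical point `Im f₁ = D(z)`. On the branch `α = π/2 + (i/2) log z`, the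
relation `log z + log z' + log z'' = πi` turns `f₁'` into `i (log z'' - log z') + η`. Thus
criticality means `logRatio z = iη`, whose exponential is `z + 1/z = 2 - B`. In the upper half-plane
this determines `z` and loses no information (`logRatio_eq_iff`, `eq_of_add_one_div_eq`). Everything
about `f₂` is the case `-η`.

Geometric side. The edge equations say `logRatio (z 0) = -logRatio (z 1)`, and the meridian has
holonomy `2 logRatio (z 1)`. Hence the shapes for cone angle `2|η|` are `z₁, z₂` in one of the two
orders.

Volume. In terms of its dihedral angles, a tetrahedron has volume `Λ(a) + Λ(b) + Λ(π - a - b)`, by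
direct integration in cylindrical coordinates; `D` of its shape is the same sum, by differentiating
in `b` (`hypVolume_idealTetrahedron_triangleVertex`, `blochWigner_triangleVertex`). -/

/-! ### Holomorphy of the dilogarithm -/

open Complex in
theorem dilog_eq (z : ℂ) : dilog z = -∫ s in (0 : ℝ)..1, log (1 - s * z) / s := by
  unfold dilog
  congr 1
  refine intervalIntegral.integral_congr fun s _ => ?_
  rcases eq_or_ne z 0 with rfl | hz
  · simp
  rcases eq_or_ne s 0 with rfl | hs
  · simp
  have : (s : ℂ) ≠ 0 := ofReal_ne_zero.2 hs
  field_simp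

open Complex in
theorem one_sub_smul_mem_slitPlane {z : ℂ} (hz : 1 - z ∈ slitPlane) {s : ℝ}
    (hs : s ∈ Set.Icc (0 : ℝ) 1) : 1 - (s : ℂ) * z ∈ slitPlane := by
  have h := starConvex_one_slitPlane.add_smul_sub_mem hz hs.1 hs.2
  convert h using 1
  simp only [real_smul]
  ring

open Complex in
theorem hasDerivAt_log_one_sub_ofReal_mul {z : ℂ} {s : ℝ} (h : 1 - (s : ℂ) * z ∈ slitPlane) :
    HasDerivAt (fun s : ℝ => log (1 - s * z)) (-z / (1 - s * z)) s := by
  have h1 : HasDerivAt (fun s : ℝ => 1 - (s : ℂ) * z) (-z) s := by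
    simpa using ((hasDerivAt_id s).ofReal_comp.mul_const z).const_sub 1
  exact h1.clog_real h

-- For `s ≠ 0` the integrand is the difference quotient at `0` of `s ↦ log (1 - s z)`, so `dslope`
-- extends it continuously over `s = 0`.
open Complex in
theorem intervalIntegrable_log_one_sub_div {z : ℂ} (hz : 1 - z ∈ slitPlane) :
    IntervalIntegrable (fun s : ℝ => log (1 - s * z) / s) MeasureTheory.volume 0 1 := by
  set f : ℝ → ℂ := fun s => log (1 - s * z) with hf
  set S : Set ℝ := {s | 1 - (s : ℂ) * z ∈ slitPlane} with hS
  have hSo : IsOpen S := isOpen_slitPlane.preimage (by fun_prop)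
  have hd : ∀ s ∈ S, DifferentiableAt ℝ f s := fun s hs =>
    (hasDerivAt_log_one_sub_ofReal_mul hs).differentiableAt
  have h0 : (0 : ℝ) ∈ S := by simp [hS]
  have hc : ContinuousOn (dslope f 0) S :=
    (continuousOn_dslope (hSo.mem_nhds h0)).2
      ⟨fun s hs => (hd s hs).continuousAt.continuousWithinAt, hd 0 h0⟩
  have hi : IntervalIntegrable (dslope f 0) MeasureTheory.volume 0 1 := by
    refine (hc.mono fun s hs => ?_).intervalIntegrable
    rw [Set.uIcc_of_le zero_le_one] at hs
    exact one_sub_smul_mem_slitPlane hz hs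
  refine hi.congr fun s hs => ?_
  rw [Set.uIoc_of_le zero_le_one] at hs
  rw [dslope_of_ne _ hs.1.ne', slope_def_module]
  simp [hf, div_eq_inv_mul]

-- Differentiation under the integral sign. The derivative is left as an integral so that `z = 0` is
-- covered; continuity of `dilog` there is needed to start the comparison with Lobachevsky
-- functions.
open Complex in
theorem hasDerivAt_dilog_integral {z : ℂ} (hz : 1 - z ∈ slitPlane) :
    HasDerivAt dilog (∫ s in (0 : ℝ)..1, 1 / (1 - (s : ℂ) * z)) z := by
  have hopen : IsOpen {w : ℂ | 1 - w ∈ slitPlane} := isOpen_slitPlane.preimage (by fun_prop)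
  obtain ⟨ε, hε, hball⟩ := Metric.nhds_basis_closedBall.mem_iff.1 (hopen.mem_nhds hz)
  -- The domain is star-shaped about `0`, so the segments to a closed ball inside it form a compact
  -- family on which the `w`-derivative of the integrand is bounded.
  have hcomp : IsCompact (Set.Icc (0 : ℝ) 1 ×ˢ Metric.closedBall z ε) :=
    isCompact_Icc.prod (isCompact_closedBall z ε)
  have hne : ∀ p ∈ Set.Icc (0 : ℝ) 1 ×ˢ Metric.closedBall z ε, 1 - (p.1 : ℂ) * p.2 ∈ slitPlane :=
    fun p hp => one_sub_smul_mem_slitPlane (hball hp.2) hp.1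
  obtain ⟨C, hC⟩ := hcomp.exists_bound_of_continuousOn
    (f := fun p : ℝ × ℂ => -1 / (1 - (p.1 : ℂ) * p.2))
    (ContinuousOn.div (by fun_prop) (by fun_prop) fun p hp => slitPlane_ne_zero (hne p hp))
  have key := intervalIntegral.hasDerivAt_integral_of_dominated_loc_of_deriv_le
    (μ := MeasureTheory.volume) (a := 0) (b := 1) (F := fun (w : ℂ) (s : ℝ) => log (1 - s * w) / s)
    (F' := fun (w : ℂ) (s : ℝ) => -1 / (1 - s * w)) (x₀ := z) (bound := fun _ => C)
    (Metric.closedBall_mem_nhds z hε)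
    (.of_forall fun w => (by fun_prop : Measurable _).aestronglyMeasurable)
    (intervalIntegrable_log_one_sub_div hz)
    (by fun_prop : Measurable _).aestronglyMeasurable
    (.of_forall fun s hs w hw => hC (s, w) ⟨?_, hw⟩) (by simp)
    (.of_forall fun s hs w hw => ?_)
  · have h := key.2.neg
    have e : (fun w => -∫ s in (0 : ℝ)..1, log (1 - s * w) / s) = dilog := by
      funext w; rw [dilog_eq]
    have h2 : HasDerivAt dilog (-∫ s in (0 : ℝ)..1, -1 / (1 - (s : ℂ) * z)) z := by
      rw [← e]; exact h
    convert h2 using 1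
    rw [← intervalIntegral.integral_neg]
    congr 1; funext s; ring
  · rw [Set.uIoc_of_le zero_le_one] at hs
    exact Set.Ioc_subset_Icc_self hs
  · rw [Set.uIoc_of_le zero_le_one] at hs
    have hs0 : (s : ℂ) ≠ 0 := ofReal_ne_zero.2 hs.1.ne'
    have hm : 1 - (s : ℂ) * w ∈ slitPlane := hne (s, w) ⟨Set.Ioc_subset_Icc_self hs, hw⟩
    have hm0 := slitPlane_ne_zero hm
    have h1 : HasDerivAt (fun w : ℂ => 1 - (s : ℂ) * w) (-s) w := by
      simpa using ((hasDerivAt_id w).const_mul (s : ℂ)).const_sub 1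
    refine ((h1.clog hm).div_const (s : ℂ)).congr_deriv ?_
    field_simp

open Complex in
/-- The dilogarithm is holomorphic off `[1, ∞)`, with derivative `-log (1 - z) / z`. -/
theorem hasDerivAt_dilog {z : ℂ} (hz : 1 - z ∈ slitPlane) (h0 : z ≠ 0) :
    HasDerivAt dilog (-log (1 - z) / z) z := by
  convert hasDerivAt_dilog_integral hz using 1
  have hm : ∀ s ∈ Set.uIcc (0 : ℝ) 1, 1 - (s : ℂ) * z ∈ slitPlane := fun s hs =>
    one_sub_smul_mem_slitPlane hz (by rwa [Set.uIcc_of_le zero_le_one] at hs)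
  have h := intervalIntegral.integral_eq_sub_of_hasDerivAt
    (f := fun s : ℝ => -log (1 - s * z) / z) (f' := fun s : ℝ => 1 / (1 - (s : ℂ) * z))
    (a := 0) (b := 1) (fun s hs => ?_) ?_
  · rw [h]; simp
  · refine (((hasDerivAt_log_one_sub_ofReal_mul (hm s hs)).neg).div_const z).congr_deriv ?_
    have := slitPlane_ne_zero (hm s hs)
    field_simp
  · exact (ContinuousOn.div (by fun_prop) (by fun_prop) fun s hs =>
      slitPlane_ne_zero (hm s hs)).intervalIntegrable

theorem dilog_zero : dilog 0 = 0 := by simp [dilog]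

open Complex in
theorem one_sub_mem_slitPlane_of_forall_ne {z : ℂ} (h : ∀ r : ℝ, 1 ≤ r → z ≠ r) :
    1 - z ∈ slitPlane := by
  rw [mem_slitPlane_iff]
  by_contra! hc
  simp only [sub_re, one_re, sub_im, one_im] at hc
  exact h z.re (by linarith [hc.1]) (Complex.ext (by simp) (by simpa using hc.2))

/-! ### The potential functions and the identity for their imaginary part -/

theorem potential₂_eq (η : ℝ) : potential₂ η = potential₁ (-η) := by
  funext α
  simp only [potential₁, potential₂]
  push_cast
  ring

open Complex in
theorem hasDerivAt_potential₁ (η : ℝ) {α : ℂ} (h : 1 - -exp (-2 * α * I) ∈ slitPlane) :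
    HasDerivAt (potential₁ η) (2 * I * log (1 - -exp (-2 * α * I)) - 2 * α + η) α := by
  have h0 : -exp (-2 * α * I) ≠ 0 := neg_ne_zero.2 (exp_ne_zero _)
  have h1 : HasDerivAt (fun α : ℂ => -exp (-2 * α * I)) (-(exp (-2 * α * I) * (-2 * I))) α := by
    have : HasDerivAt (fun α : ℂ => -2 * α * I) (-2 * I) α := by
      simpa using ((hasDerivAt_id α).const_mul (-2 : ℂ)).mul_const I
    exact this.cexp.neg
  have h2 := (((hasDerivAt_dilog h h0).comp α h1).sub ((hasDerivAt_id α).pow 2)).add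
    ((hasDerivAt_id α).const_mul (η : ℂ)) |>.add_const ((Real.pi : ℂ) ^ 2 / 12)
  have e : 2 * I * log (1 - -exp (-2 * α * I)) - 2 * α + η =
      -log (1 - -exp (-2 * α * I)) / -exp (-2 * α * I) * -(exp (-2 * α * I) * (-2 * I)) -
        (2 : ℕ) * id α ^ (2 - 1) * 1 + η * 1 := by
    have := exp_ne_zero (-2 * α * I)
    simp only [id]
    field_simp
    push_cast
    ring
  rw [e]
  exact h2

open Complex in
theorem hasDerivAt_im_potential₁ (η x y : ℝ)
    (h : 1 - -exp (-2 * (x + y * I) * I) ∈ slitPlane) :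
    HasDerivAt (fun t : ℝ => (potential₁ η (x + t * I)).im)
      (2 * I * log (1 - -exp (-2 * (x + y * I) * I)) - 2 * (x + y * I) + η).re y := by
  have h1 : HasDerivAt (fun t : ℝ => (x : ℂ) + t * I) I y := by
    simpa using ((hasDerivAt_id y).ofReal_comp.mul_const I).const_add (x : ℂ)
  have h2 := (hasDerivAt_potential₁ η h).comp y h1
  have h3 := (imCLM.hasFDerivAt (x := potential₁ η (x + y * I))).comp_hasDerivAt y h2
  refine h3.congr_deriv ?_
  rw [mul_comm _ I]; simp [-mul_re, -mul_im, I_mul_im]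

-- Since `ln|z| = 2y`, the term `Arg(1 - z) ln|z|` cancels against the real part of `2i y log (1 -
-- z)`. This is pure algebra and holds on the cut as well.
open Complex in
theorem im_potential₁_eq (η x y : ℝ) :
    (potential₁ η (x + y * I)).im = blochWigner (-exp (-2 * (x + y * I) * I)) +
      y * (2 * I * log (1 - -exp (-2 * (x + y * I) * I)) - 2 * (x + y * I) + η).re := by
  have hn : Real.log ‖-exp (-2 * (x + y * I) * I)‖ = 2 * y := by
    rw [norm_neg, norm_exp, Real.log_exp]
    simp
  rw [blochWigner, hn, potential₁]
  have hp : ((Real.pi : ℂ) ^ 2 / 12).im = 0 := by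
    rw [← ofReal_pow, show (12 : ℂ) = ((12 : ℝ) : ℂ) by simp, ← ofReal_div, ofReal_im]
  simp only [add_im, sub_im, hp]
  generalize dilog _ = d
  rw [← log_im]
  generalize log _ = l
  simp [pow_two]
  ring

/-! ### Logarithms of shape parameters -/

-- Lifts multiplicative relations between shape parameters to relations between their logarithms.
open Complex in
theorem eq_of_exp_eq_of_abs_im_sub_lt {a b : ℂ} (h : exp a = exp b)
    (him : |a.im - b.im| < 2 * Real.pi) : a = b := by
  obtain ⟨n, hn⟩ := exp_eq_exp_iff_exists_int.1 h
  have h1 : a.im - b.im = n * (2 * Real.pi) := by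
    rw [hn]; simp
  rw [h1, abs_mul, abs_of_pos Real.two_pi_pos] at him
  have h2 : |(n : ℝ)| < 1 := by
    by_contra! hc
    nlinarith [Real.two_pi_pos]
  have h3 : n = 0 := by
    rw [← Int.cast_abs] at h2
    exact Int.abs_lt_one_iff.1 (by exact_mod_cast h2)
  simpa [h3] using hn

open Complex in
theorem log_im_mem_Ioo_of_im_pos {z : ℂ} (hz : 0 < z.im) : (log z).im ∈ Set.Ioo 0 Real.pi := by
  rw [log_im]
  refine ⟨(arg_nonneg_iff.2 hz.le).lt_of_ne' fun h => ?_, (arg_le_pi z).lt_of_ne fun h => ?_⟩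
  · exact hz.ne' (arg_eq_zero_iff.1 h).2
  · exact hz.ne' (arg_eq_pi_iff.1 h).2

theorem ne_zero_of_im_pos {z : ℂ} (hz : 0 < z.im) : z ≠ 0 := by
  rintro rfl; simp at hz

theorem one_sub_ne_zero_of_im_pos {z : ℂ} (hz : 0 < z.im) : 1 - z ≠ 0 := fun h => by
  have := congrArg Complex.im h
  simp at this
  exact hz.ne' this

theorem inv_im_neg {z : ℂ} (hz : 0 < z.im) : (z⁻¹).im < 0 := by
  rw [Complex.inv_im]
  exact div_neg_of_neg_of_pos (neg_lt_zero.2 hz) (Complex.normSq_pos.2 (ne_zero_of_im_pos hz))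

theorem one_sub_one_div_im_pos {z : ℂ} (hz : 0 < z.im) : 0 < (1 - 1 / z).im := by
  have := inv_im_neg hz
  simp only [one_div, Complex.sub_im, Complex.one_im]
  linarith

theorem one_div_one_sub_im_pos {z : ℂ} (hz : 0 < z.im) : 0 < (1 / (1 - z)).im := by
  rw [one_div, Complex.inv_im]
  refine div_pos ?_ (Complex.normSq_pos.2 (one_sub_ne_zero_of_im_pos hz))
  simpa using hz

theorem one_sub_mem_slitPlane_of_im_pos {z : ℂ} (hz : 0 < z.im) : 1 - z ∈ Complex.slitPlane :=
  Complex.mem_slitPlane_iff.2 (Or.inr (by simpa using hz.ne'))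

open Complex in
theorem log_one_div_one_sub {z : ℂ} (hz : 0 < z.im) : log (1 / (1 - z)) = -log (1 - z) := by
  rw [one_div, log_inv _ (slitPlane_arg_ne_pi (one_sub_mem_slitPlane_of_im_pos hz))]

open Complex in
/-- The dihedral angles of an ideal tetrahedron at one vertex sum up to `π`. -/
theorem log_add_log_add_log {z : ℂ} (hz : 0 < z.im) :
    log z + log (1 / (1 - z)) + log (1 - 1 / z) = Real.pi * I := by
  have h1 := log_im_mem_Ioo_of_im_pos hz
  have h2 := log_im_mem_Ioo_of_im_pos (one_div_one_sub_im_pos hz)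
  have h3 := log_im_mem_Ioo_of_im_pos (one_sub_one_div_im_pos hz)
  have n1 := ne_zero_of_im_pos hz
  have n2 := one_sub_ne_zero_of_im_pos hz
  apply eq_of_exp_eq_of_abs_im_sub_lt
  · rw [exp_add, exp_add, exp_log n1, exp_log (ne_zero_of_im_pos (one_div_one_sub_im_pos hz)),
      exp_log (ne_zero_of_im_pos (one_sub_one_div_im_pos hz)), exp_pi_mul_I]
    field_simp
    ring
  · simp only [add_im, mul_im, ofReal_re, I_im, ofReal_im, I_re, Set.mem_Ioo] at *
    rw [abs_lt]
    constructor <;> linarith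

/-! ### The critical point equation -/

/-- The difference of the logarithms of the shape parameters `z''` and `z'`. -/
noncomputable def logRatio (z : ℂ) : ℂ := Complex.log (1 - 1 / z) - Complex.log (1 / (1 - z))

open Complex in
theorem exp_logRatio {z : ℂ} (hz : 0 < z.im) : exp (logRatio z) = 2 - (z + 1 / z) := by
  have n1 := ne_zero_of_im_pos hz
  have n2 := one_sub_ne_zero_of_im_pos hz
  rw [logRatio, exp_sub, exp_log (ne_zero_of_im_pos (one_div_one_sub_im_pos hz)),
      exp_log (ne_zero_of_im_pos (one_sub_one_div_im_pos hz))]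
  field_simp
  ring

-- Both logarithms in `logRatio` have imaginary part in `(0, π)`, so that of `logRatio z` lies in
-- `(-π, π)`, like `η`; exponentiating therefore creates no ambiguity.
open Complex in
theorem logRatio_eq_iff {z : ℂ} (hz : 0 < z.im) {η : ℝ} (hη : η ∈ Set.Ioo (-Real.pi) Real.pi) :
    logRatio z = η * I ↔ z + 1 / z = 2 - exp (η * I) := by
  have he := exp_logRatio hz
  constructor
  · intro h
    rw [← h, he]; ring
  · intro h
    have h2 := log_im_mem_Ioo_of_im_pos (one_div_one_sub_im_pos hz)
    have h3 := log_im_mem_Ioo_of_im_pos (one_sub_one_div_im_pos hz)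
    apply eq_of_exp_eq_of_abs_im_sub_lt
    · rw [he, h]; ring
    · simp only [logRatio, sub_im, mul_im, ofReal_re, I_im, ofReal_im, I_re, Set.mem_Ioo] at *
      rw [abs_lt]
      constructor <;> linarith

/-- The other solution is `1/z`, which lies in the lower half-plane. -/
theorem eq_of_add_one_div_eq {z w : ℂ} (hz : 0 < z.im) (hw : 0 < w.im)
    (h : z + 1 / z = w + 1 / w) : z = w := by
  have n1 := ne_zero_of_im_pos hz
  have n2 := ne_zero_of_im_pos hw
  have h1 : (z - w) * (z * w - 1) = 0 := by
    field_simp at h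
    linear_combination h
  rcases mul_eq_zero.1 h1 with h2 | h2
  · exact sub_eq_zero.1 h2
  · have : w = z⁻¹ := by
      field_simp
      linear_combination h2
    exact absurd hw (not_lt.2 (this ▸ (inv_im_neg hz).le))

/-! ### The root of the quadratic and its position in the upper half-plane -/

open Complex in
theorem cpow_half_sq (w : ℂ) : (w ^ (1 / 2 : ℂ)) ^ 2 = w := by
  rw [one_div]
  exact_mod_cast cpow_nat_inv_pow w two_ne_zero

open Complex in
theorem cpow_half_re_pos {w : ℂ} (hw : w ∈ slitPlane) : 0 < (w ^ (1 / 2 : ℂ)).re := by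
  rw [cpow_def_of_ne_zero (slitPlane_ne_zero hw), exp_re]
  refine mul_pos (Real.exp_pos _) (Real.cos_pos_of_mem_Ioo ?_)
  have h1 : (log w * (1 / 2)).im = arg w / 2 := by
    rw [show (1 / 2 : ℂ) = ((1 / 2 : ℝ) : ℂ) by push_cast; rfl, im_mul_ofReal, log_im]; ring
  have h2 := neg_pi_lt_arg w
  have h3 := (arg_le_pi w).lt_of_ne (slitPlane_arg_ne_pi hw)
  rw [h1]
  constructor <;> linarith

theorem quadraticRoot_add_one_div (B : ℂ) : quadraticRoot B + 1 / quadraticRoot B = 2 - B := by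
  have h := cpow_half_sq (4 - (2 - B) ^ 2)
  have h1 : quadraticRoot B ^ 2 + 1 = (2 - B) * quadraticRoot B := by
    rw [quadraticRoot]
    linear_combination (Complex.I ^ 2 / 4) * h + ((4 - (2 - B) ^ 2) / 4) * Complex.I_sq
  have h0 : quadraticRoot B ≠ 0 := by
    intro h0
    simp [h0] at h1
  field_simp
  linear_combination h1

theorem shape₂_eq (η : ℝ) : shape₂ η = shape₁ (-η) := by
  simp [shape₁, shape₂]

open Complex in
theorem discriminant_re (η : ℝ) : (4 - (2 - exp (η * I)) ^ 2).re =
    4 * Real.cos η - 2 * Real.cos η ^ 2 + 1 := by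
  have := Real.sin_sq_add_cos_sq η
  rw [exp_mul_I, ← ofReal_cos, ← ofReal_sin]
  simp [pow_two, -ofReal_cos, -ofReal_sin]
  linear_combination this

open Complex in
theorem discriminant_im (η : ℝ) : (4 - (2 - exp (η * I)) ^ 2).im =
    2 * (Real.sin η * (2 - Real.cos η)) := by
  rw [exp_mul_I, ← ofReal_cos, ← ofReal_sin]
  simp [pow_two, -ofReal_cos, -ofReal_sin]
  ring

-- The imaginary part `2 sin η (2 - cos η)` vanishes only at `η = 0`, where the number is `3`.
open Complex in
theorem discriminant_mem_slitPlane {η : ℝ} (hη : η ∈ Set.Ioo (-Real.pi) Real.pi) :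
    4 - (2 - exp (η * I)) ^ 2 ∈ slitPlane := by
  rw [mem_slitPlane_iff, discriminant_re, discriminant_im]
  rcases eq_or_ne η 0 with rfl | h0
  · left; norm_num
  · right
    have h1 : Real.sin η ≠ 0 := fun h =>
      h0 ((Real.sin_eq_zero_iff_of_lt_of_lt hη.1 hη.2).1 h)
    have h2 : 2 - Real.cos η ≠ 0 := by linarith [Real.cos_le_one η]
    simp [h1, h2]

open Complex in
theorem shape₁_im_pos {η : ℝ} (hη : η ∈ Set.Ioo (-Real.pi) Real.pi) : 0 < (shape₁ η).im := by
  have hs := cpow_half_re_pos (discriminant_mem_slitPlane hη)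
  have hsq := cpow_half_sq (4 - (2 - exp (η * I)) ^ 2)
  have hre := discriminant_re η
  have him := discriminant_im η
  rw [shape₁, quadraticRoot]
  set s := (4 - (2 - exp (η * I)) ^ 2) ^ (1 / 2 : ℂ) with hs_def
  rw [← hsq] at hre him
  have e : ((2 - exp (η * I) + I * s) / 2).im = (s.re - Real.sin η) / 2 := by
    rw [exp_mul_I, ← ofReal_cos, ← ofReal_sin, show (2 : ℂ) = ((2 : ℝ) : ℂ) by simp, div_ofReal_im]
    simp [-ofReal_cos, -ofReal_sin]
    ring
  rw [e]
  simp only [pow_two, mul_re, mul_im] at hre him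
  suffices Real.sin η < s.re by linarith
  -- If `0 < Re s ≤ sin η`, the imaginary part of `s²` forces `Im s ≥ 2 - cos η`. Then `Re s² ≤ sin²
  -- η - (2 - cos η)²`, which is smaller by `4` than its actual value.
  by_contra! hc
  have hq : 2 - Real.cos η ≤ s.im := by
    have h1 : s.re * s.im = Real.sin η * (2 - Real.cos η) := by linarith
    have h2 : 0 < 2 - Real.cos η := by linarith [Real.cos_le_one η]
    by_contra! h3
    nlinarith [mul_lt_mul_of_pos_left h3 hs, mul_le_mul_of_nonneg_right hc h2.le]
  nlinarith [Real.sin_sq_add_cos_sq η, Real.cos_le_one η]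

theorem shape₁_add_one_div (η : ℝ) :
    shape₁ η + 1 / shape₁ η = 2 - Complex.exp (η * Complex.I) :=
  quadraticRoot_add_one_div _

theorem logRatio_shape₁ {η : ℝ} (hη : η ∈ Set.Ioo (-Real.pi) Real.pi) :
    logRatio (shape₁ η) = η * Complex.I :=
  (logRatio_eq_iff (shape₁_im_pos hη) hη).2 (shape₁_add_one_div η)

theorem eq_shape₁_of_logRatio_eq {z : ℂ} (hz : 0 < z.im) {η : ℝ}
    (hη : η ∈ Set.Ioo (-Real.pi) Real.pi) (h : logRatio z = η * Complex.I) : z = shape₁ η :=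
  eq_of_add_one_div_eq hz (shape₁_im_pos hη)
    (((logRatio_eq_iff hz hη).1 h).trans (shape₁_add_one_div η).symm)

open Complex in
theorem continuousOn_shape₁ : ContinuousOn shape₁ (Set.Ioo (-Real.pi) Real.pi) := by
  have : ContinuousOn (fun η : ℝ => (4 - (2 - exp (η * I)) ^ 2) ^ (1 / 2 : ℂ))
      (Set.Ioo (-Real.pi) Real.pi) :=
    ContinuousOn.cpow (by fun_prop) continuousOn_const fun η hη => discriminant_mem_slitPlane hη
  unfold shape₁ quadraticRoot
  fun_prop

open Complex in
theorem shape₁_zero : shape₁ 0 = exp ((Real.pi / 3 : ℝ) * I) := by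
  have h0 : (0 : ℝ) ∈ Set.Ioo (-Real.pi) Real.pi := ⟨by linarith [Real.pi_pos], Real.pi_pos⟩
  refine eq_of_add_one_div_eq (shape₁_im_pos h0) ?_ ?_
  · rw [exp_ofReal_mul_I_im, Real.sin_pi_div_three]
    positivity
  · rw [shape₁_add_one_div, one_div, ← exp_neg, ← neg_mul, ← ofReal_neg]
    apply Complex.ext
    · simp only [add_re, exp_ofReal_mul_I_re, Real.cos_neg, Real.cos_pi_div_three]
      simp; norm_num
    · simp only [add_im, exp_ofReal_mul_I_im, Real.sin_neg]
      simp

/-! ### Critical branches and critical values -/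

/-- The critical branch expressed by the principal logarithm. -/
noncomputable def logBranch (z : ℂ) : ℂ := Real.pi / 2 + Complex.I / 2 * Complex.log z

open Complex in
theorem neg_exp_logBranch {z : ℂ} (hz : z ≠ 0) : -exp (-2 * logBranch z * I) = z := by
  have : -2 * logBranch z * I = log z - Real.pi * I := by
    rw [logBranch]
    linear_combination (-log z) * I_sq
  rw [this, exp_sub, exp_log hz, exp_pi_mul_I]
  ring

open Complex in
theorem isCriticalBranch_logBranch :
    IsCriticalBranch shape₁ (fun η => logBranch (shape₁ η)) where
  continuousOn := by
    unfold logBranch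
    have : ContinuousOn (fun η => log (shape₁ η)) (Set.Ioo (-Real.pi) Real.pi) :=
      continuousOn_shape₁.clog fun η hη =>
        mem_slitPlane_iff.2 (Or.inr (shape₁_im_pos hη).ne')
    fun_prop
  at_zero := by
    have := Real.pi_pos
    rw [shape₁_zero, logBranch, log_exp]
    · push_cast
      linear_combination (Real.pi / 6 : ℂ) * I_sq
    · simp; linarith
    · simp; linarith
  eq_exp η hη := (neg_exp_logBranch (ne_zero_of_im_pos (shape₁_im_pos hη))).symm

open Complex in
theorem IsCriticalBranch.comp_neg {α : ℝ → ℂ} (h : IsCriticalBranch shape₁ α) :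
    IsCriticalBranch shape₂ (fun η => α (-η)) where
  continuousOn := h.continuousOn.comp continuousOn_neg fun η hη =>
    ⟨neg_lt_neg hη.2, by simpa using neg_lt_neg hη.1⟩
  at_zero := by simpa using h.at_zero
  eq_exp η hη := by
    rw [← h.eq_exp (-η) ⟨neg_lt_neg hη.2, by simpa using neg_lt_neg hη.1⟩, shape₂_eq]

-- Two branches differ by an integer multiple of `π`; the integer is continuous in `η` on a
-- connected interval and is `0` at `η = 0`.
open Complex in
theorem IsCriticalBranch.eq_of_eq {z α β : ℝ → ℂ} (hα : IsCriticalBranch z α)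
    (hβ : IsCriticalBranch z β) {η : ℝ} (hη : η ∈ Set.Ioo (-Real.pi) Real.pi) : α η = β η := by
  have hpi : (Real.pi : ℂ) ≠ 0 := ofReal_ne_zero.2 Real.pi_ne_zero
  have hint : ∀ η ∈ Set.Ioo (-Real.pi) Real.pi, ∃ n : ℤ, α η - β η = n * Real.pi := by
    intro η hη
    have h := (hα.eq_exp η hη).symm.trans (hβ.eq_exp η hη)
    obtain ⟨n, hn⟩ := exp_eq_exp_iff_exists_int.1 (neg_injective h)
    refine ⟨-n, ?_⟩
    push_cast
    linear_combination (I / 2) * hn + (α η - β η + n * Real.pi) * I_sq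
  have : DiscreteTopology (Set.range ((↑) : ℤ → ℝ)) :=
    Int.isClosedEmbedding_coe_real.isEmbedding.toHomeomorph.symm.isEmbedding.discreteTopology
  have h0 : (0 : ℝ) ∈ Set.Ioo (-Real.pi) Real.pi := ⟨by linarith [Real.pi_pos], Real.pi_pos⟩
  have hcont : ContinuousOn (fun η => ((α η - β η) / Real.pi).re) (Set.Ioo (-Real.pi) Real.pi) :=
    continuous_re.comp_continuousOn ((hα.continuousOn.sub hβ.continuousOn).div_const _)
  have hc := isPreconnected_Ioo.constant_of_mapsTo
    (T := Set.range ((↑) : ℤ → ℝ)) ⟨this⟩ hcont (fun η hη => ?_) hη h0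
  · obtain ⟨n, hn⟩ := hint η hη
    simp only [hn, hα.at_zero, hβ.at_zero, sub_self, zero_div, zero_re,
      mul_div_cancel_right₀ _ hpi, intCast_re] at hc
    simpa [sub_eq_zero, show n = 0 by exact_mod_cast hc] using hn
  · obtain ⟨n, hn⟩ := hint η hη
    exact ⟨n, by simp [hn, hpi]⟩

open Complex in
theorem hasDerivAt_potential₁_logBranch {η : ℝ} (hη : η ∈ Set.Ioo (-Real.pi) Real.pi) :
    HasDerivAt (potential₁ η) 0 (logBranch (shape₁ η)) := by
  have hz := shape₁_im_pos hη
  have hu := neg_exp_logBranch (ne_zero_of_im_pos hz)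
  have h := hasDerivAt_potential₁ η (α := logBranch (shape₁ η))
    (by rw [hu]; exact one_sub_mem_slitPlane_of_im_pos hz)
  rw [hu] at h
  refine h.congr_deriv ?_
  have h1 := logRatio_shape₁ hη
  have h2 := log_add_log_add_log hz
  rw [logRatio] at h1
  rw [log_one_div_one_sub hz] at h1 h2
  rw [logBranch]
  linear_combination I * h1 - I * h2 - (Real.pi - η : ℂ) * I_sq

-- The derivative term of the identity (1) drops out at a critical point.
open Complex in
theorem im_potential₁_logBranch {η : ℝ} (hη : η ∈ Set.Ioo (-Real.pi) Real.pi) :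
    (potential₁ η (logBranch (shape₁ η))).im = blochWigner (shape₁ η) := by
  have hz := shape₁_im_pos hη
  have hu := neg_exp_logBranch (ne_zero_of_im_pos hz)
  have hslit : 1 - -exp (-2 * logBranch (shape₁ η) * I) ∈ slitPlane := by
    rw [hu]; exact one_sub_mem_slitPlane_of_im_pos hz
  have h := (hasDerivAt_potential₁ η hslit).unique (hasDerivAt_potential₁_logBranch hη)
  have h2 := im_potential₁_eq η (logBranch (shape₁ η)).re (logBranch (shape₁ η)).im
  rw [re_add_im, h, hu] at h2
  simpa using h2

/-! ### The Lobachevsky function -/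

/-- The Lobachevsky function `-∫₀^θ log (2 sin t) dt` for `0 ≤ θ ≤ π`. -/
noncomputable def lobachevsky (θ : ℝ) : ℝ :=
  -(θ * Real.log 2) - ∫ t in (0 : ℝ)..θ, Real.log (Real.sin t)

theorem intervalIntegrable_log_sin' (a b : ℝ) :
    IntervalIntegrable (fun t => Real.log (Real.sin t)) MeasureTheory.volume a b :=
  intervalIntegrable_log_sin

theorem continuous_lobachevsky : Continuous lobachevsky :=
  (by fun_prop : Continuous fun θ : ℝ => -(θ * Real.log 2)).sub
    (intervalIntegral.continuous_primitive intervalIntegrable_log_sin' 0)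

theorem lobachevsky_zero : lobachevsky 0 = 0 := by simp [lobachevsky]

theorem hasDerivAt_lobachevsky {θ : ℝ} (hθ : θ ∈ Set.Ioo 0 Real.pi) :
    HasDerivAt lobachevsky (-Real.log 2 - Real.log (Real.sin θ)) θ := by
  have hs : Real.sin θ ≠ 0 := (Real.sin_pos_of_mem_Ioo hθ).ne'
  have h1 : HasDerivAt (fun θ : ℝ => -(θ * Real.log 2)) (-Real.log 2) θ := by
    exact ((hasDerivAt_id θ).mul_const (Real.log 2)).neg.congr_deriv (by simp)
  refine h1.sub (intervalIntegral.integral_hasDerivAt_right (intervalIntegrable_log_sin' 0 θ) ?_ ?_)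
  · exact (Real.measurable_log.comp Real.measurable_sin).stronglyMeasurable.stronglyMeasurableAtFilter
  · exact Real.continuous_sin.continuousAt.log hs

/-- Follows from the symmetry of `sin` about `π/2` and `∫₀^π log sin = -π log 2`. -/
theorem lobachevsky_pi_sub (θ : ℝ) : lobachevsky (Real.pi - θ) = -lobachevsky θ := by
  have h1 := intervalIntegral.integral_add_adjacent_intervals
    (intervalIntegrable_log_sin' 0 (Real.pi - θ)) (intervalIntegrable_log_sin' (Real.pi - θ) Real.pi)
  have h2 := intervalIntegral.integral_comp_sub_left (a := 0) (b := θ)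
    (fun t => Real.log (Real.sin t)) Real.pi
  simp only [Real.sin_pi_sub, sub_zero] at h2
  rw [integral_log_sin_zero_pi] at h1
  simp only [lobachevsky]
  linarith

/-! ### Shapes in terms of dihedral angles, and the Bloch–Wigner function -/

/-- The third vertex of the Euclidean triangle with vertices `0, 1` and angles `a, b` there. -/
noncomputable def triangleVertex (a b : ℝ) : ℂ :=
  (Real.sin b / Real.sin (a + b) : ℝ) * Complex.exp (a * Complex.I)

theorem sin_mul_exp_identity (a b : ℝ) :
    (Real.sin (a + b) : ℂ) - Real.sin b * Complex.exp (a * Complex.I) =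
      Real.sin a * Complex.exp ((-b : ℝ) * Complex.I) := by
  apply Complex.ext
  · simp only [Complex.sub_re, Complex.ofReal_re, Complex.re_ofReal_mul,
      Complex.exp_ofReal_mul_I_re, Real.sin_add, Real.cos_neg]
    ring
  · simp only [Complex.sub_im, Complex.ofReal_im, Complex.im_ofReal_mul,
      Complex.exp_ofReal_mul_I_im, Real.sin_neg]
    ring

theorem one_sub_triangleVertex {a b : ℝ} (h : Real.sin (a + b) ≠ 0) :
    1 - triangleVertex a b =
      (Real.sin a / Real.sin (a + b) : ℝ) * Complex.exp ((-b : ℝ) * Complex.I) := by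
  have h' : (Real.sin (a + b) : ℂ) ≠ 0 := Complex.ofReal_ne_zero.2 h
  have := sin_mul_exp_identity a b
  rw [triangleVertex, Complex.ofReal_div, Complex.ofReal_div]
  generalize Complex.exp ((-b : ℝ) * Complex.I) = e at *
  field_simp
  linear_combination this

theorem triangleVertex_im (a b : ℝ) :
    (triangleVertex a b).im = Real.sin b / Real.sin (a + b) * Real.sin a := by
  rw [triangleVertex, Complex.im_ofReal_mul, Complex.exp_ofReal_mul_I_im]

theorem triangleVertex_re (a b : ℝ) :
    (triangleVertex a b).re = Real.sin b / Real.sin (a + b) * Real.cos a := by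
  rw [triangleVertex, Complex.re_ofReal_mul, Complex.exp_ofReal_mul_I_re]

-- Take `a = arg z` and `b = -arg (1 - z)`. The law of sines `|z| sin (a + b) = sin b` gives `sin (a
-- + b) > 0`, which excludes `a + b ≥ π`.
open Complex in
theorem exists_eq_triangleVertex {z : ℂ} (hz : 0 < z.im) :
    ∃ a b : ℝ, 0 < a ∧ 0 < b ∧ a + b < Real.pi ∧ z = triangleVertex a b := by
  have ha := log_im_mem_Ioo_of_im_pos hz
  have hb := log_im_mem_Ioo_of_im_pos (one_div_one_sub_im_pos hz)
  rw [log_one_div_one_sub hz, neg_im] at hb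
  rw [log_im] at ha hb
  have n1 := norm_pos_iff.2 (ne_zero_of_im_pos hz)
  have n2 := norm_pos_iff.2 (one_sub_ne_zero_of_im_pos hz)
  have e1 := norm_mul_exp_arg_mul_I z
  have e2 := norm_mul_exp_arg_mul_I (1 - z)
  set a := arg z
  set b := -arg (1 - z) with hb_def
  have hb' : arg (1 - z) = -b := by simp [hb_def]
  rw [hb'] at e2
  have i1 := congrArg im e1
  have i2 := congrArg im e2
  have r1 := congrArg re e1
  have r2 := congrArg re e2
  simp only [im_ofReal_mul, re_ofReal_mul, exp_ofReal_mul_I_im, exp_ofReal_mul_I_re, Real.sin_neg,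
    Real.cos_neg, sub_re, sub_im, one_re, one_im] at i1 i2 r1 r2
  have key : ‖z‖ * Real.sin (a + b) = Real.sin b := by
    rw [Real.sin_add]
    linear_combination Real.cos b * i1 + Real.cos b * i2 + Real.sin b * r1 + Real.sin b * r2
  have hsb := Real.sin_pos_of_mem_Ioo hb
  have hs : 0 < Real.sin (a + b) := by
    by_contra! hc
    nlinarith
  have hab : a + b < Real.pi := by
    by_contra! hc
    have h := Real.sin_nonneg_of_nonneg_of_le_pi (x := a + b - Real.pi) (by linarith)
      (by linarith [ha.2, hb.2])
    rw [Real.sin_sub_pi] at h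
    linarith
  refine ⟨a, b, ha.1, hb.1, hab, ?_⟩
  rw [triangleVertex, ← key, mul_div_cancel_right₀ _ hs.ne', e1]

theorem sin_pos_of_triangle {a b : ℝ} (ha : 0 < a) (hb : 0 < b) (hab : a + b < Real.pi) :
    0 < Real.sin a ∧ 0 < Real.sin b ∧ 0 < Real.sin (a + b) :=
  ⟨Real.sin_pos_of_pos_of_lt_pi ha (by linarith), Real.sin_pos_of_pos_of_lt_pi hb (by linarith),
    Real.sin_pos_of_pos_of_lt_pi (by linarith) hab⟩

theorem triangleVertex_im_pos {a b : ℝ} (ha : 0 < a) (hb : 0 < b) (hab : a + b < Real.pi) :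
    0 < (triangleVertex a b).im := by
  obtain ⟨h1, h2, h3⟩ := sin_pos_of_triangle ha hb hab
  rw [triangleVertex_im]
  positivity

theorem arg_one_sub_triangleVertex {a b : ℝ} (ha : 0 < a) (hb : 0 < b) (hab : a + b < Real.pi) :
    (1 - triangleVertex a b).arg = -b := by
  obtain ⟨h1, h2, h3⟩ := sin_pos_of_triangle ha hb hab
  rw [one_sub_triangleVertex h3.ne', Complex.arg_real_mul _ (by positivity), Complex.exp_mul_I,
    Complex.arg_cos_add_sin_mul_I ⟨by linarith, by linarith⟩]

theorem norm_triangleVertex {a b : ℝ} (ha : 0 < a) (hb : 0 < b) (hab : a + b < Real.pi) :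
    ‖triangleVertex a b‖ = Real.sin b / Real.sin (a + b) := by
  obtain ⟨h1, h2, h3⟩ := sin_pos_of_triangle ha hb hab
  rw [triangleVertex, norm_mul, Complex.norm_exp_ofReal_mul_I, Complex.norm_real, mul_one,
    Real.norm_of_nonneg (by positivity)]

theorem hasDerivAt_triangleVertex {a b : ℝ} (ha : 0 < a) (hb : 0 < b) (hab : a + b < Real.pi) :
    HasDerivAt (triangleVertex a)
      ((Real.cos b / Real.sin b - Real.cos (a + b) / Real.sin (a + b) : ℝ) * triangleVertex a b)
      b := by
  obtain ⟨h1, h2, h3⟩ := sin_pos_of_triangle ha hb hab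
  have hd : HasDerivAt (fun b => Real.sin (a + b)) (Real.cos (a + b)) b := by
    simpa using ((hasDerivAt_id b).const_add a).sin
  refine ((((Real.hasDerivAt_sin b).div hd h3.ne').ofReal_comp).mul_const
    (Complex.exp (a * Complex.I))).congr_deriv ?_
  rw [triangleVertex, ← mul_assoc, ← Complex.ofReal_mul]
  congr 2
  field_simp

-- With `a` fixed the vertex moves along a ray from `0`, so its logarithmic derivative `m` is real
-- and the derivative of `dilog` is `-m log (1 - z)`, with imaginary part `m b`.
open Complex in
theorem hasDerivAt_im_dilog_triangleVertex {a b : ℝ} (ha : 0 < a) (hb : 0 < b)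
    (hab : a + b < Real.pi) :
    HasDerivAt (fun b => (dilog (triangleVertex a b)).im)
      (b * (Real.cos b / Real.sin b - Real.cos (a + b) / Real.sin (a + b))) b := by
  have hz := triangleVertex_im_pos ha hb hab
  have h1 := (hasDerivAt_dilog (one_sub_mem_slitPlane_of_im_pos hz)
    (ne_zero_of_im_pos hz)).scomp b (hasDerivAt_triangleVertex ha hb hab)
  have h2 := (imCLM.hasFDerivAt (x := dilog (triangleVertex a b))).comp_hasDerivAt b h1
  refine h2.congr_deriv ?_
  have h3 := ne_zero_of_im_pos hz
  have h4 : (log (1 - triangleVertex a b)).im = -b := by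
    rw [log_im, arg_one_sub_triangleVertex ha hb hab]
  generalize Real.cos b / Real.sin b - Real.cos (a + b) / Real.sin (a + b) = m
  rw [smul_eq_mul, show (m : ℂ) * triangleVertex a b *
    (-log (1 - triangleVertex a b) / triangleVertex a b) =
      ((-m : ℝ) : ℂ) * log (1 - triangleVertex a b) by push_cast; field_simp]
  rw [imCLM_apply, im_ofReal_mul, h4]
  ring

/-- Writing `sin b = b · sinc b` moves the singularity at `0` into `b log b`, which is continuous
there. -/
theorem continuousOn_mul_log_sin :
    ContinuousOn (fun b => b * Real.log (Real.sin b)) (Set.Ico 0 Real.pi) := by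
  have h : ContinuousOn (fun b => b * Real.log b + b * Real.log (Real.sinc b))
      (Set.Ico 0 Real.pi) := by
    refine Real.continuous_mul_log.continuousOn.add (continuousOn_id.mul
      (Real.continuous_sinc.continuousOn.log fun b hb => ?_))
    rcases hb.1.eq_or_lt with rfl | h0
    · simp
    · rw [Real.sinc_of_ne_zero h0.ne']
      exact (div_pos (Real.sin_pos_of_pos_of_lt_pi h0 hb.2) h0).ne'
  refine h.congr fun b hb => ?_
  rcases hb.1.eq_or_lt with rfl | h0
  · simp
  · have := (Real.sin_pos_of_pos_of_lt_pi h0 hb.2).ne'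
    simp only
    rw [Real.sinc_of_ne_zero h0.ne', Real.log_div this h0.ne']
    ring

/-- The Bloch–Wigner dilogarithm as a sum of Lobachevsky functions of the dihedral angles. -/
theorem blochWigner_triangleVertex {a b : ℝ} (ha : 0 < a) (hb : 0 < b) (hab : a + b < Real.pi) :
    blochWigner (triangleVertex a b) =
      lobachevsky a + lobachevsky b + lobachevsky (Real.pi - a - b) := by
  -- The difference of the two sides as a function of `b`. Its derivative vanishes, and it is `0` at
  -- `b = 0`, where the triangle degenerates to the vertex `0`.
  set F : ℝ → ℝ := fun b => (dilog (triangleVertex a b)).im -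
    (b * Real.log (Real.sin b) - b * Real.log (Real.sin (a + b))) -
    (lobachevsky a + lobachevsky b + lobachevsky (Real.pi - a - b)) with hF
  have hsin : ∀ x ∈ Set.Icc 0 b, Real.sin (a + x) ≠ 0 := fun x hx =>
    (Real.sin_pos_of_pos_of_lt_pi (by linarith [hx.1]) (by linarith [hx.2])).ne'
  have hcont : ContinuousOn F (Set.Icc 0 b) := by
    have hv : ContinuousOn (triangleVertex a) (Set.Icc 0 b) := by
      have : ContinuousOn (fun x => Real.sin x / Real.sin (a + x)) (Set.Icc 0 b) :=
        ContinuousOn.div (by fun_prop) (by fun_prop) hsin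
      unfold triangleVertex
      exact (Complex.continuous_ofReal.comp_continuousOn this).mul continuousOn_const
    have hdil : ContinuousOn (fun x => (dilog (triangleVertex a x)).im) (Set.Icc 0 b) := by
      refine Complex.continuous_im.comp_continuousOn fun x hx => ?_
      have hs : 1 - triangleVertex a x ∈ Complex.slitPlane := by
        rcases hx.1.eq_or_lt with rfl | h0
        · simp [triangleVertex]
        · exact one_sub_mem_slitPlane_of_im_pos
            (triangleVertex_im_pos ha h0 (by linarith [hx.2]))
      exact (hasDerivAt_dilog_integral hs).continuousAt.comp_continuousWithinAt (hv x hx)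
    refine (hdil.sub ((continuousOn_mul_log_sin.mono fun x hx => ⟨hx.1, ?_⟩).sub
      (continuousOn_id.mul (ContinuousOn.log (by fun_prop) hsin)))).sub ?_
    · linarith [hx.2]
    · have := continuous_lobachevsky
      exact Continuous.continuousOn (by fun_prop)
  have hder : ∀ x ∈ Set.Ioo 0 b, HasDerivAt F 0 x := by
    intro x hx
    have hax : a + x < Real.pi := by linarith [hx.2]
    obtain ⟨h1, h2, h3⟩ := sin_pos_of_triangle ha hx.1 hax
    have d1 := hasDerivAt_im_dilog_triangleVertex ha hx.1 hax
    have d2 : HasDerivAt (fun x => x * Real.log (Real.sin x))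
        (1 * Real.log (Real.sin x) + x * (Real.cos x / Real.sin x)) x :=
      (hasDerivAt_id x).mul ((Real.hasDerivAt_sin x).log h2.ne')
    have d3 : HasDerivAt (fun x => x * Real.log (Real.sin (a + x)))
        (1 * Real.log (Real.sin (a + x)) + x * (Real.cos (a + x) * 1 / Real.sin (a + x))) x :=
      (hasDerivAt_id x).mul ((((hasDerivAt_id x).const_add a).sin).log h3.ne')
    have d4 := hasDerivAt_lobachevsky (θ := x) ⟨hx.1, by linarith⟩
    have d5 : HasDerivAt (fun x => lobachevsky (Real.pi - a - x))
        ((-Real.log 2 - Real.log (Real.sin (Real.pi - a - x))) * (-1)) x :=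
      (hasDerivAt_lobachevsky (θ := Real.pi - a - x)
        ⟨by linarith, by linarith [hx.1]⟩).comp x ((hasDerivAt_id x).const_sub (Real.pi - a))
    refine ((d1.sub (d2.sub d3)).sub ((d4.const_add (lobachevsky a)).add d5)).congr_deriv ?_
    rw [show Real.pi - a - x = Real.pi - (a + x) by ring, Real.sin_pi_sub]
    ring
  obtain ⟨c, hc, hslope⟩ := exists_hasDerivAt_eq_slope F (fun _ => 0) hb hcont hder
  have h0 : F 0 = 0 := by
    simp [hF, triangleVertex, dilog_zero, lobachevsky_zero, lobachevsky_pi_sub]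
  have hFb : F b = 0 := by
    rw [eq_comm, div_eq_zero_iff, h0] at hslope
    rcases hslope with h | h <;> linarith
  obtain ⟨h1, h2, h3⟩ := sin_pos_of_triangle ha hb hab
  rw [blochWigner, arg_one_sub_triangleVertex ha hb hab, norm_triangleVertex ha hb hab,
    Real.log_div h2.ne' h3.ne']
  simp only [hF] at hFb
  linarith

/-! ### The ideal tetrahedron in upper half-space coordinates -/

theorem hermitianOf_eq_sum_iff (z : ℂ) (c : Fin 4 → ℝ) (p : HypSpace) :
    hermitianOf p =
      ∑ j, (c j : ℂ) • Matrix.vecMulVec (idealVertex z j) (star (idealVertex z j)) ↔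
    Complex.normSq p.1.1 + p.1.2 ^ 2 = p.1.2 * (c 0 + c 2 + c 3 * Complex.normSq z) ∧
      p.1.1.re = p.1.2 * (c 2 + c 3 * z.re) ∧ p.1.1.im = p.1.2 * (c 3 * z.im) ∧
      1 = p.1.2 * (c 1 + c 2 + c 3) := by
  obtain ⟨⟨w, t⟩, ht : 0 < t⟩ := p
  simp only [Fin.sum_univ_four, ← Matrix.ext_iff, Fin.forall_fin_two, hermitianOf, idealVertex,
    Complex.normSq_eq_norm_sq]
  simp [Matrix.vecMulVec, Complex.ext_iff, ← Complex.normSq_eq_norm_sq, Complex.normSq_apply]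
  have e1 : ((t : ℂ) ^ 2).re = t ^ 2 := by rw [← Complex.ofReal_pow, Complex.ofReal_re]
  have e2 : ((t : ℂ) ^ 2).im = 0 := by rw [← Complex.ofReal_pow, Complex.ofReal_im]
  have e3 : ∀ s : ℝ, t⁻¹ = s ↔ 1 = t * s := fun s => by
    rw [← inv_mul_eq_iff_eq_mul₀ ht.ne', mul_one]
  simp only [e1, e2, e3, inv_mul_eq_iff_eq_mul₀ ht.ne']
  constructor
  · rintro ⟨⟨⟨h1, -⟩, h2, h3⟩, -, h4⟩
    exact ⟨h1, h2, h3, h4⟩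
  · rintro ⟨h1, h2, h3, h4⟩
    exact ⟨⟨⟨h1, by ring⟩, h2, h3⟩, ⟨h2, h3⟩, h4⟩

/-- The inequalities are the signs of the weights `c 3`, `c 2`, `c 1`, `c 0`: the first three bound
the vertical prism over the triangle `0, 1, z`, the last is the exterior of the hemisphere through
these points. -/
theorem mem_idealTetrahedron_iff {z : ℂ} (hz : 0 < z.im) (p : HypSpace) :
    p ∈ idealTetrahedron z ↔ 0 ≤ p.1.1.im ∧ 0 ≤ p.1.1.re * z.im - p.1.1.im * z.re ∧
      p.1.1.re * z.im + p.1.1.im * (1 - z.re) ≤ z.im ∧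
      p.1.1.re * z.im + p.1.1.im * (Complex.normSq z - z.re) ≤
        (Complex.normSq p.1.1 + p.1.2 ^ 2) * z.im := by
  simp only [idealTetrahedron, Set.mem_ofPred_eq, hermitianOf_eq_sum_iff]
  obtain ⟨⟨w, t⟩, ht : 0 < t⟩ := p
  simp only
  constructor
  · rintro ⟨c, hc, h1, h2, h3, h4⟩
    rw [h1, h2, h3]
    have e0 := mul_nonneg (mul_nonneg ht.le (hc 0)) hz.le
    have e1 := mul_nonneg (mul_nonneg ht.le (hc 1)) hz.le
    have e2 := mul_nonneg (mul_nonneg ht.le (hc 2)) hz.le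
    have e3 := mul_nonneg (mul_nonneg ht.le (hc 3)) hz.le
    refine ⟨by linarith, by linarith, ?_, by linarith⟩
    linear_combination e1 - z.im * h4
  · rintro ⟨h1, h2, h3, h4⟩
    have hty : 0 < t * z.im := mul_pos ht hz
    -- The unique solution of the linear system for the weights.
    refine ⟨![((Complex.normSq w + t ^ 2) * z.im -
        (w.re * z.im + w.im * (Complex.normSq z - z.re))) / (t * z.im),
      (z.im - (w.re * z.im + w.im * (1 - z.re))) / (t * z.im),
      (w.re * z.im - w.im * z.re) / (t * z.im), w.im / (t * z.im)], ?_, ?_, ?_, ?_, ?_⟩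
    · intro j
      fin_cases j
      · exact div_nonneg (by linarith) hty.le
      · exact div_nonneg (by linarith) hty.le
      · exact div_nonneg (by linarith) hty.le
      · exact div_nonneg (by linarith) hty.le
    all_goals
      simp only [Matrix.cons_val]
      field_simp
      try ring

/-! ### Integrating the volume form -/

theorem lintegral_one_div_cube {q : ℝ} (hq : 0 < q) :
    ∫⁻ t in {t : ℝ | 0 < t ∧ q ≤ t ^ 2}, ENNReal.ofReal (1 / t ^ 3) =
      ENNReal.ofReal (1 / (2 * q)) := by
  have hs := Real.sqrt_pos.2 hq
  have hset : {t : ℝ | 0 < t ∧ q ≤ t ^ 2} = Set.Ici (Real.sqrt q) := by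
    ext t
    constructor
    · rintro ⟨h1, h2⟩
      exact Real.sqrt_le_iff.2 ⟨h1.le, h2⟩
    · intro h
      have : 0 < t := hs.trans_le h
      exact ⟨this, (Real.sqrt_le_iff.1 h).2⟩
  rw [hset, MeasureTheory.setLIntegral_congr MeasureTheory.Ioi_ae_eq_Ici.symm]
  have hcongr : ∀ t ∈ Set.Ioi (Real.sqrt q), t ^ (-3 : ℝ) = 1 / t ^ 3 := fun t ht => by
    rw [Real.rpow_neg (hs.trans ht).le, one_div]
    norm_cast
  rw [← MeasureTheory.ofReal_integral_eq_lintegral_ofReal,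
    ← MeasureTheory.setIntegral_congr_fun measurableSet_Ioi hcongr,
    integral_Ioi_rpow_of_lt (by norm_num) hs]
  · congr 1
    rw [show (-3 + 1 : ℝ) = -2 by norm_num, Real.rpow_neg hs.le]
    norm_cast
    rw [Real.sq_sqrt hq.le]
    field_simp
    norm_num
  · exact (integrableOn_Ioi_rpow_of_lt (by norm_num) hs).congr_fun hcongr measurableSet_Ioi
  · filter_upwards [MeasureTheory.ae_restrict_mem measurableSet_Ioi] with t ht
    have : 0 < t := hs.trans ht
    positivity

theorem lintegral_one_div_sub {k R : ℝ} (hR : 0 < R) (hk : R < k) :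
    ∫⁻ r in Set.Ioc 0 R, ENNReal.ofReal (1 / (2 * (k - r))) =
      ENNReal.ofReal (1 / 2 * Real.log (k / (k - R))) := by
  have hne : ∀ r ∈ Set.uIcc 0 R, k - r ≠ 0 := fun r hr => by
    rw [Set.uIcc_of_le hR.le] at hr
    linarith [hr.2]
  have hcont : ContinuousOn (fun r => 1 / (2 * (k - r))) (Set.uIcc 0 R) :=
    ContinuousOn.div (by fun_prop) (by fun_prop) fun r hr => mul_ne_zero two_ne_zero (hne r hr)
  rw [← MeasureTheory.ofReal_integral_eq_lintegral_ofReal, ← intervalIntegral.integral_of_le hR.le,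
    intervalIntegral.integral_eq_sub_of_hasDerivAt (f := fun r => -(1 / 2 * Real.log (k - r)))
      (fun r hr => ?_) hcont.intervalIntegrable]
  · rw [Real.log_div (by linarith) (by linarith)]
    congr 1
    simp
    ring
  · have h1 : HasDerivAt (fun r => k - r) (-1) r := (hasDerivAt_id r).const_sub k
    refine ((h1.log (hne r hr)).const_mul (1 / 2)).neg.congr_deriv ?_
    have := hne r hr
    field_simp
  · exact (intervalIntegrable_iff_integrableOn_Ioc_of_le hR.le).1 hcont.intervalIntegrable
  · filter_upwards [MeasureTheory.ae_restrict_mem measurableSet_Ioc] with r hr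
    have : 0 ≤ k - r := by linarith [hr.2]
    simp only [Pi.zero_apply]
    positivity

theorem measurableSet_idealTetrahedron {z : ℂ} (hz : 0 < z.im) :
    MeasurableSet (idealTetrahedron z) := by
  have : idealTetrahedron z = {p : HypSpace | 0 ≤ p.1.1.im ∧
      0 ≤ p.1.1.re * z.im - p.1.1.im * z.re ∧
      p.1.1.re * z.im + p.1.1.im * (1 - z.re) ≤ z.im ∧
      p.1.1.re * z.im + p.1.1.im * (Complex.normSq z - z.re) ≤
        (Complex.normSq p.1.1 + p.1.2 ^ 2) * z.im} :=
    Set.ext fun p => mem_idealTetrahedron_iff hz p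
  rw [this]
  have hn : Continuous fun p : HypSpace => Complex.normSq p.1.1 :=
    Complex.continuous_normSq.comp (by fun_prop)
  refine IsClosed.measurableSet ?_
  exact (isClosed_le (by fun_prop) (by fun_prop)).and ((isClosed_le (by fun_prop) (by fun_prop)).and
    ((isClosed_le (by fun_prop) (by fun_prop)).and (isClosed_le (by fun_prop) (by fun_prop))))

section Volume

open MeasureTheory

theorem hypVolume_idealTetrahedron {z : ℂ} (hz : 0 < z.im) :
    hypVolume (idealTetrahedron z) =
      ∫⁻ p in Subtype.val '' idealTetrahedron z, ENNReal.ofReal (1 / p.2 ^ 3)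
        ∂(volume : Measure (ℂ × ℝ)) := by
  have hpos : MeasurableSet {p : ℂ × ℝ | 0 < p.2} := measurableSet_lt (by fun_prop) (by fun_prop)
  have hT := measurableSet_idealTetrahedron hz
  have hU : MeasurableSet ((Subtype.val : HypSpace → ℂ × ℝ) '' idealTetrahedron z) :=
    hpos.subtype_image hT
  rw [hypVolume, withDensity_apply _ hT, ← lintegral_indicator hT, ← lintegral_indicator hU]
  set f := (Subtype.val '' idealTetrahedron z).indicator
    fun p : ℂ × ℝ => ENNReal.ofReal (1 / p.2 ^ 3) with hf
  have h1 : {p : ℂ × ℝ | 0 < p.2}.indicator f = f := by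
    refine Set.indicator_eq_self.2 fun p hp => ?_
    obtain ⟨q, -, rfl⟩ := Set.mem_of_indicator_ne_zero hp
    exact q.2
  rw [← h1, lintegral_indicator hpos, ← lintegral_subtype_comap hpos]
  refine lintegral_congr fun p => ?_
  by_cases hp : p ∈ idealTetrahedron z
  · rw [Set.indicator_of_mem hp, hf, Set.indicator_of_mem (Set.mem_image_of_mem _ hp)]
  · rw [Set.indicator_of_notMem hp, hf, Set.indicator_of_notMem]
    rwa [Subtype.val_injective.mem_set_image]

theorem lintegral_eq_lintegral_polar {U : Set (ℂ × ℝ)} (hU : MeasurableSet U) {g : ℝ → ENNReal}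
    (hg : Measurable g) :
    ∫⁻ p in U, g p.2 ∂(volume : Measure (ℂ × ℝ)) =
      ∫⁻ φ in Set.Ioo (-Real.pi) Real.pi, ∫⁻ r in Set.Ioi (0 : ℝ), ENNReal.ofReal r *
        ∫⁻ t in {t : ℝ | ((r * (Real.cos φ + Real.sin φ * Complex.I) : ℂ), t) ∈ U}, g t := by
  have hm : Measurable (U.indicator fun p => g p.2) := (hg.comp measurable_snd).indicator hU
  have hm2 : Measurable fun w : ℂ => ∫⁻ t, U.indicator (fun p => g p.2) (w, t) :=
    hm.lintegral_prod_right'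
  rw [← lintegral_indicator hU, Measure.volume_eq_prod, lintegral_prod _ hm.aemeasurable,
    ← Complex.lintegral_comp_polarCoord_symm,
    show polarCoord.target = Set.Ioi 0 ×ˢ Set.Ioo (-Real.pi) Real.pi from rfl, Measure.volume_eq_prod,
    setLIntegral_prod_symm]
  · refine lintegral_congr fun φ => lintegral_congr fun r => ?_
    rw [Complex.polarCoord_symm_apply, smul_eq_mul, ← lintegral_indicator]
    · rfl
    · exact hU.preimage measurable_prodMk_left
  · simp_rw [Complex.polarCoord_symm_apply, smul_eq_mul]
    refine Measurable.aemeasurable (Measurable.mul (by fun_prop) (hm2.comp ?_))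
    fun_prop

/-- Along the ray of angle `φ`, the side from `1` to `z` is met at `r = sin b / sin (φ + b)`, and
the circle through `0, 1, z` again at `k = sin (a + b - φ) / sin (a + b)`; the hemisphere over it
has height `t² = r (k - r)`. -/
theorem mem_idealTetrahedron_polar_iff {a b : ℝ} (ha : 0 < a) (hb : 0 < b)
    (hab : a + b < Real.pi) {r : ℝ} (hr : 0 < r) (φ t : ℝ) :
    ((r * (Real.cos φ + Real.sin φ * Complex.I) : ℂ), t) ∈
        (Subtype.val '' idealTetrahedron (triangleVertex a b) : Set (ℂ × ℝ)) ↔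
      (0 ≤ Real.sin φ ∧ 0 ≤ Real.sin (a - φ) ∧ r * Real.sin (φ + b) ≤ Real.sin b) ∧
        0 < t ∧ r * (Real.sin (a + b - φ) / Real.sin (a + b) - r) ≤ t ^ 2 := by
  obtain ⟨h1, h2, h3⟩ := sin_pos_of_triangle ha hb hab
  have hz := triangleVertex_im_pos ha hb hab
  have hw : ((Subtype.val '' idealTetrahedron (triangleVertex a b) : Set (ℂ × ℝ))
      (r * (Real.cos φ + Real.sin φ * Complex.I), t)) ↔ ∃ ht : 0 < t,
      (⟨(r * (Real.cos φ + Real.sin φ * Complex.I), t), ht⟩ : HypSpace) ∈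
        idealTetrahedron (triangleVertex a b) := by
    constructor
    · rintro ⟨⟨p, hp⟩, hp', rfl⟩
      exact ⟨hp, hp'⟩
    · rintro ⟨ht, h⟩
      exact ⟨_, h, rfl⟩
  have hre : ((r : ℂ) * (Real.cos φ + Real.sin φ * Complex.I)).re = r * Real.cos φ := by
    simp [-Complex.ofReal_cos, -Complex.ofReal_sin]
  have him : ((r : ℂ) * (Real.cos φ + Real.sin φ * Complex.I)).im = r * Real.sin φ := by
    simp [-Complex.ofReal_cos, -Complex.ofReal_sin]
  refine hw.trans ?_
  simp only [mem_idealTetrahedron_iff hz, Complex.normSq_apply, hre, him, triangleVertex_re,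
    triangleVertex_im, exists_prop]
  set s := Real.sin (a + b) with hs
  set m := Real.sin b / s with hm
  have hm0 : 0 < m := div_pos h2 h3
  have hms : m * s = Real.sin b := div_mul_cancel₀ _ h3.ne'
  have c1 : 0 ≤ r * Real.sin φ ↔ 0 ≤ Real.sin φ := mul_nonneg_iff_of_pos_left hr
  have c2 : 0 ≤ r * Real.cos φ * (m * Real.sin a) - r * Real.sin φ * (m * Real.cos a) ↔
      0 ≤ Real.sin (a - φ) := by
    rw [← mul_nonneg_iff_of_pos_left (mul_pos hr hm0) (b := Real.sin _), Real.sin_sub]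
    ring_nf
  have c3 : r * Real.cos φ * (m * Real.sin a) + r * Real.sin φ * (1 - m * Real.cos a) ≤
      m * Real.sin a ↔ r * Real.sin (φ + b) ≤ Real.sin b := by
    rw [← mul_le_mul_iff_of_pos_right h3, ← mul_le_mul_iff_of_pos_right h1 (b := r * _)]
    have e1 : (r * Real.cos φ * (m * Real.sin a) + r * Real.sin φ * (1 - m * Real.cos a)) * s =
        r * Real.sin (φ + b) * Real.sin a := by
      have : s = Real.sin a * Real.cos b + Real.cos a * Real.sin b := Real.sin_add a b
      rw [Real.sin_add]
      linear_combination r * (Real.cos φ * Real.sin a - Real.sin φ * Real.cos a) * hms +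
        r * Real.sin φ * this
    have e2 : m * Real.sin a * s = Real.sin b * Real.sin a := by linear_combination Real.sin a * hms
    rw [e1, e2]
  have c4 : r * Real.cos φ * (m * Real.sin a) + r * Real.sin φ *
      (m * Real.cos a * (m * Real.cos a) + m * Real.sin a * (m * Real.sin a) - m * Real.cos a) ≤
      (r * Real.cos φ * (r * Real.cos φ) + r * Real.sin φ * (r * Real.sin φ) + t ^ 2) *
        (m * Real.sin a) ↔ r * (Real.sin (a + b - φ) / s - r) ≤ t ^ 2 := by
    have e1 : r * (Real.sin (a + b - φ) / s - r) = r * Real.sin (a + b - φ) / s - r ^ 2 := by ring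
    have hma := mul_pos hm0 h1
    rw [e1, sub_le_iff_le_add, div_le_iff₀ h3, ← mul_le_mul_iff_of_pos_right h3]
    have h5 : s = Real.sin a * Real.cos b + Real.cos a * Real.sin b := Real.sin_add a b
    have h6 : Real.sin (a + b - φ) = s * Real.cos φ -
        (Real.cos a * Real.cos b - Real.sin a * Real.sin b) * Real.sin φ := by
      rw [Real.sin_sub, Real.cos_add]
    have h7 := Real.sin_sq_add_cos_sq a
    have h8 := Real.sin_sq_add_cos_sq φ
    have e2 : (r * Real.cos φ * (m * Real.sin a) + r * Real.sin φ *
      (m * Real.cos a * (m * Real.cos a) + m * Real.sin a * (m * Real.sin a) - m * Real.cos a)) *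
        s = r * Real.sin (a + b - φ) * (m * Real.sin a) := by
      rw [h6]
      linear_combination (r * Real.sin φ * m * s * m) * h7 + r * Real.sin φ * m * hms -
        r * Real.sin φ * m * Real.cos a * h5 - r * Real.sin φ * m * Real.sin b * h7
    have e3 : (r * Real.cos φ * (r * Real.cos φ) + r * Real.sin φ * (r * Real.sin φ) + t ^ 2) *
        (m * Real.sin a) * s = (t ^ 2 + r ^ 2) * s * (m * Real.sin a) := by
      linear_combination r ^ 2 * m * Real.sin a * s * h8
    rw [e2, e3, mul_le_mul_iff_of_pos_right hma]
  rw [c1, c2, c3, c4]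
  tauto

theorem sin_mul_sin_add_sin_mul_sin (a b φ : ℝ) :
    Real.sin b * Real.sin (a + b) + Real.sin φ * Real.sin (a - φ) =
      Real.sin (φ + b) * Real.sin (a + b - φ) := by
  have h1 := Real.sin_sq_add_cos_sq a
  have h2 := Real.sin_sq_add_cos_sq b
  have h3 := Real.sin_sq_add_cos_sq φ
  simp only [Real.sin_add, Real.sin_sub, Real.cos_add]
  generalize Real.sin a = A, Real.cos a = A', Real.sin b = B, Real.cos b = B', Real.sin φ = P,
    Real.cos φ = P' at *
  linear_combination (-(A' * B ^ 2 + A * B * B')) * h3 + (P ^ 2 * A' - P * P' * A) * h2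

/-- The vertical integral is `1 / (2 r (k - r))`, and the Jacobian `r` cancels, leaving `½ log (k /
(k - R))`. The identity `sin_mul_sin_add_sin_mul_sin` factors `k - R`, so the logarithm splits into
four log-sines. -/
theorem radial_lintegral_eq {a b φ : ℝ} (ha : 0 < a) (hb : 0 < b) (hab : a + b < Real.pi)
    (hφ : φ ∈ Set.Ioo 0 a) :
    ∫⁻ r in Set.Ioi (0 : ℝ), ENNReal.ofReal r *
        ∫⁻ t in {t : ℝ | ((r * (Real.cos φ + Real.sin φ * Complex.I) : ℂ), t) ∈
          (Subtype.val '' idealTetrahedron (triangleVertex a b) : Set (ℂ × ℝ))},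
            ENNReal.ofReal (1 / t ^ 3) =
      ENNReal.ofReal (1 / 2 * (Real.log (Real.sin (φ + b)) + Real.log (Real.sin (a + b - φ)) -
        Real.log (Real.sin φ) - Real.log (Real.sin (a - φ)))) := by
  obtain ⟨h1, h2, h3⟩ := sin_pos_of_triangle ha hb hab
  have s1 : 0 < Real.sin φ := Real.sin_pos_of_pos_of_lt_pi hφ.1 (by linarith [hφ.2])
  have s2 : 0 < Real.sin (a - φ) :=
    Real.sin_pos_of_pos_of_lt_pi (by linarith [hφ.2]) (by linarith [hφ.1])
  have s3 : 0 < Real.sin (φ + b) :=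
    Real.sin_pos_of_pos_of_lt_pi (by linarith [hφ.1]) (by linarith [hφ.2])
  have s4 : 0 < Real.sin (a + b - φ) :=
    Real.sin_pos_of_pos_of_lt_pi (by linarith [hφ.2]) (by linarith [hφ.1])
  set k := Real.sin (a + b - φ) / Real.sin (a + b) with hk
  set R := Real.sin b / Real.sin (φ + b) with hR
  have hR0 : 0 < R := div_pos h2 s3
  have hkR : k - R = Real.sin φ * Real.sin (a - φ) / (Real.sin (a + b) * Real.sin (φ + b)) := by
    rw [hk, hR]
    field_simp
    linear_combination -sin_mul_sin_add_sin_mul_sin a b φ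
  have hkR0 : 0 < k - R := by rw [hkR]; positivity
  have hlog : Real.log (k / (k - R)) = Real.log (Real.sin (φ + b)) +
      Real.log (Real.sin (a + b - φ)) - Real.log (Real.sin φ) - Real.log (Real.sin (a - φ)) := by
    have : k / (k - R) =
        Real.sin (φ + b) * Real.sin (a + b - φ) / (Real.sin φ * Real.sin (a - φ)) := by
      rw [hkR, hk]
      field_simp
    rw [this, Real.log_div (by positivity) (by positivity), Real.log_mul s3.ne' s4.ne',
      Real.log_mul s1.ne' s2.ne']
    ring
  rw [← hlog, ← lintegral_one_div_sub hR0 (by linarith), ← lintegral_indicator measurableSet_Ioi,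
    ← lintegral_indicator measurableSet_Ioc]
  refine lintegral_congr fun r => ?_
  by_cases hr : 0 < r
  · rw [Set.indicator_of_mem (show r ∈ Set.Ioi 0 from hr)]
    simp only [mem_idealTetrahedron_polar_iff ha hb hab hr]
    by_cases hrR : r ≤ R
    · rw [Set.indicator_of_mem (show r ∈ Set.Ioc 0 R from ⟨hr, hrR⟩)]
      have hcond : 0 ≤ Real.sin φ ∧ 0 ≤ Real.sin (a - φ) ∧ r * Real.sin (φ + b) ≤ Real.sin b :=
        ⟨s1.le, s2.le, (le_div_iff₀ s3).1 hrR⟩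
      have hkr : 0 < k - r := by linarith
      simp only [hcond, true_and, and_self]
      rw [lintegral_one_div_cube (mul_pos hr hkr), ← ENNReal.ofReal_mul hr.le]
      congr 1
      field_simp
    · rw [Set.indicator_of_notMem fun h => hrR h.2]
      have hcond : ¬(r * Real.sin (φ + b) ≤ Real.sin b) := fun h => hrR ((le_div_iff₀ s3).2 h)
      simp [hcond]
  · rw [Set.indicator_of_notMem (show r ∉ Set.Ioi 0 from hr), Set.indicator_of_notMem fun h => hr h.1]

theorem radial_lintegral_eq_zero {a b φ : ℝ} (ha : 0 < a) (hb : 0 < b) (hab : a + b < Real.pi)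
    (hφ : φ ∈ Set.Ioo (-Real.pi) Real.pi) (hφ' : φ ∉ Set.Icc 0 a) :
    ∫⁻ r in Set.Ioi (0 : ℝ), ENNReal.ofReal r *
        ∫⁻ t in {t : ℝ | ((r * (Real.cos φ + Real.sin φ * Complex.I) : ℂ), t) ∈
          (Subtype.val '' idealTetrahedron (triangleVertex a b) : Set (ℂ × ℝ))},
            ENNReal.ofReal (1 / t ^ 3) = 0 := by
  have hcond : ¬(0 ≤ Real.sin φ ∧ 0 ≤ Real.sin (a - φ)) := by
    rintro ⟨h1, h2⟩
    rcases lt_or_ge φ 0 with h | h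
    · linarith [Real.sin_neg_of_neg_of_neg_pi_lt h hφ.1]
    · have h3 : a < φ := by
        by_contra! hc
        exact hφ' ⟨h, hc⟩
      linarith [Real.sin_neg_of_neg_of_neg_pi_lt (x := a - φ) (by linarith) (by linarith [hφ.2])]
  rw [setLIntegral_congr_fun (g := fun _ => 0) measurableSet_Ioi, lintegral_zero]
  intro r hr
  simp only [mem_idealTetrahedron_polar_iff ha hb hab hr]
  have : ∀ P Q : Prop, ((0 ≤ Real.sin φ ∧ 0 ≤ Real.sin (a - φ) ∧ P) ∧ Q) ↔ False :=
    fun P Q => ⟨fun h => hcond ⟨h.1.1, h.1.2.1⟩, False.elim⟩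
  simp [this]

theorem integral_log_sin_eq (x y : ℝ) : ∫ t in x..y, Real.log (Real.sin t) =
    lobachevsky x - lobachevsky y - (y - x) * Real.log 2 := by
  rw [← intervalIntegral.integral_interval_sub_left (intervalIntegrable_log_sin' 0 y)
    (intervalIntegrable_log_sin' 0 x), lobachevsky, lobachevsky]
  ring

theorem angular_integral_eq (a b : ℝ) :
    IntervalIntegrable (fun φ => 1 / 2 * (Real.log (Real.sin (φ + b)) +
        Real.log (Real.sin (a + b - φ)) - Real.log (Real.sin φ) - Real.log (Real.sin (a - φ))))
        volume 0 a ∧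
    ∫ φ in (0 : ℝ)..a, 1 / 2 * (Real.log (Real.sin (φ + b)) +
        Real.log (Real.sin (a + b - φ)) - Real.log (Real.sin φ) - Real.log (Real.sin (a - φ))) =
      lobachevsky a + lobachevsky b + lobachevsky (Real.pi - a - b) := by
  have i1 : IntervalIntegrable (fun φ => Real.log (Real.sin (φ + b))) volume 0 a := by
    simpa using (intervalIntegrable_log_sin' (0 + b) (a + b)).comp_add_right b
  have i2 : IntervalIntegrable (fun φ => Real.log (Real.sin (a + b - φ))) volume 0 a := by
    simpa using (intervalIntegrable_log_sin' (a + b) b).comp_sub_left (a + b)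
  have i3 := intervalIntegrable_log_sin' 0 a
  have i4 : IntervalIntegrable (fun φ => Real.log (Real.sin (a - φ))) volume 0 a := by
    simpa using (intervalIntegrable_log_sin' a 0).comp_sub_left a
  refine ⟨(((i1.add i2).sub i3).sub i4).const_mul _, ?_⟩
  rw [intervalIntegral.integral_const_mul, intervalIntegral.integral_sub ((i1.add i2).sub i3) i4,
    intervalIntegral.integral_sub (i1.add i2) i3, intervalIntegral.integral_add i1 i2,
    intervalIntegral.integral_comp_add_right (fun t => Real.log (Real.sin t)),
    intervalIntegral.integral_comp_sub_left (fun t => Real.log (Real.sin t)),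
    intervalIntegral.integral_comp_sub_left (fun t => Real.log (Real.sin t))]
  simp only [integral_log_sin_eq, lobachevsky_zero, sub_zero, zero_add, sub_self,
    add_sub_cancel_left]
  rw [show Real.pi - a - b = Real.pi - (a + b) by ring, lobachevsky_pi_sub]
  ring

theorem angular_integrand_nonneg {a b φ : ℝ} (ha : 0 < a) (hb : 0 < b) (hab : a + b < Real.pi)
    (hφ : φ ∈ Set.Ioo 0 a) :
    0 ≤ 1 / 2 * (Real.log (Real.sin (φ + b)) + Real.log (Real.sin (a + b - φ)) -
      Real.log (Real.sin φ) - Real.log (Real.sin (a - φ))) := by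
  have s1 : 0 < Real.sin φ := Real.sin_pos_of_pos_of_lt_pi hφ.1 (by linarith [hφ.2])
  have s2 : 0 < Real.sin (a - φ) :=
    Real.sin_pos_of_pos_of_lt_pi (by linarith [hφ.2]) (by linarith [hφ.1])
  have s3 : 0 < Real.sin (φ + b) :=
    Real.sin_pos_of_pos_of_lt_pi (by linarith [hφ.1]) (by linarith [hφ.2])
  have s4 : 0 < Real.sin (a + b - φ) :=
    Real.sin_pos_of_pos_of_lt_pi (by linarith [hφ.2]) (by linarith [hφ.1])
  obtain ⟨h1, h2, h3⟩ := sin_pos_of_triangle ha hb hab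
  have := Real.log_le_log (mul_pos s1 s2)
    ((le_add_of_nonneg_left (mul_pos h2 h3).le).trans_eq (sin_mul_sin_add_sin_mul_sin a b φ))
  rw [Real.log_mul s1.ne' s2.ne', Real.log_mul s3.ne' s4.ne'] at this
  linarith

/-- Milnor's formula for the volume of an ideal tetrahedron. -/
theorem hypVolume_idealTetrahedron_triangleVertex {a b : ℝ} (ha : 0 < a) (hb : 0 < b)
    (hab : a + b < Real.pi) :
    hypVolume (idealTetrahedron (triangleVertex a b)) = ENNReal.ofReal
      (lobachevsky a + lobachevsky b + lobachevsky (Real.pi - a - b)) := by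
  have hz := triangleVertex_im_pos ha hb hab
  have hpos : MeasurableSet {p : ℂ × ℝ | 0 < p.2} := measurableSet_lt (by fun_prop) (by fun_prop)
  obtain ⟨hint, hval⟩ := angular_integral_eq a b
  refine (hypVolume_idealTetrahedron hz).trans ((lintegral_eq_lintegral_polar
    (hpos.subtype_image (measurableSet_idealTetrahedron hz))
    (g := fun t => ENNReal.ofReal (1 / t ^ 3)) (by fun_prop)).trans ?_)
  rw [← hval, intervalIntegral.integral_of_le ha.le, ofReal_integral_eq_lintegral_ofReal]
  · rw [setLIntegral_congr Ioo_ae_eq_Ioc.symm, ← lintegral_indicator measurableSet_Ioo,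
      ← lintegral_indicator measurableSet_Ioo]
    refine lintegral_congr_ae ?_
    -- The boundary rays, where the radial integral is not computed, form a null set of angles.
    have hae : ∀ᵐ φ : ℝ, φ ≠ 0 ∧ φ ≠ a := by
      rw [Filter.eventually_and]
      exact ⟨Measure.ae_ne volume 0, Measure.ae_ne volume a⟩
    filter_upwards [hae] with φ hφ
    by_cases h : φ ∈ Set.Ioo 0 a
    · rw [Set.indicator_of_mem h, Set.indicator_of_mem
        (show φ ∈ Set.Ioo (-Real.pi) Real.pi from ⟨by linarith [h.1, Real.pi_pos], by linarith [h.2]⟩),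
        radial_lintegral_eq ha hb hab h]
    · rw [Set.indicator_of_notMem h]
      by_cases h' : φ ∈ Set.Ioo (-Real.pi) Real.pi
      · rw [Set.indicator_of_mem h', radial_lintegral_eq_zero ha hb hab h']
        exact fun hc => h ⟨hc.1.lt_of_ne' hφ.1, hc.2.lt_of_ne hφ.2⟩
      · rw [Set.indicator_of_notMem h']
  · exact (intervalIntegrable_iff_integrableOn_Ioc_of_le ha.le).1 hint
  · rw [← restrict_Ioo_eq_restrict_Ioc]
    filter_upwards [ae_restrict_mem measurableSet_Ioo] with φ hφ
    exact angular_integrand_nonneg ha hb hab hφ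

theorem hypVolume_idealTetrahedron_eq {z : ℂ} (hz : 0 < z.im) :
    hypVolume (idealTetrahedron z) = ENNReal.ofReal (blochWigner z) := by
  obtain ⟨a, b, ha, hb, hab, rfl⟩ := exists_eq_triangleVertex hz
  rw [hypVolume_idealTetrahedron_triangleVertex ha hb hab, blochWigner_triangleVertex ha hb hab]

/-- Needed because `ENNReal.ofReal` truncates negative numbers. -/
theorem blochWigner_nonneg {z : ℂ} (hz : 0 < z.im) : 0 ≤ blochWigner z := by
  obtain ⟨a, b, ha, hb, hab, rfl⟩ := exists_eq_triangleVertex hz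
  rw [blochWigner_triangleVertex ha hb hab, ← (angular_integral_eq a b).2,
    intervalIntegral.integral_of_le ha.le, integral_Ioc_eq_integral_Ioo]
  exact setIntegral_nonneg measurableSet_Ioo fun φ hφ => angular_integrand_nonneg ha hb hab hφ

/-! ### Cone structures: volume, holonomy and classification -/

/-- A push-forward along a measurable map preserves total mass, so the gluing does not enter. -/
theorem ConeStructure.volume_eq {θ : ℝ} (M : ConeStructure θ) :
    M.volume = blochWigner (M.shape 0) + blochWigner (M.shape 1) := by
  have hmk : ∀ i : Fin 2, Measurable fun x : idealTetrahedron (M.shape i) => (⟨i, x⟩ : M.Pieces) :=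
    fun i => measurable_iff_le_map.2 (iInf_le _ i)
  have hquot : Measurable fun x : M.Pieces => (Quot.mk M.Glued x : M.Manifold) := measurable_quot_mk
  have hpiece : ∀ i : Fin 2, ((hypVolume.comap
      (Subtype.val : idealTetrahedron (M.shape i) → HypSpace)).map
        (fun x => (⟨i, x⟩ : M.Pieces))) Set.univ = ENNReal.ofReal (blochWigner (M.shape i)) := by
    intro i
    rw [Measure.map_apply (hmk i) MeasurableSet.univ, Set.preimage_univ,
      comap_subtype_coe_apply (measurableSet_idealTetrahedron (M.shape_im_pos i)),
      Set.image_univ, Subtype.range_coe, hypVolume_idealTetrahedron_eq (M.shape_im_pos i)]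
  have huniv : M.volumeMeasure Set.univ = M.piecesVolume Set.univ :=
    Measure.map_apply hquot MeasurableSet.univ
  rw [ConeStructure.volume, huniv, ConeStructure.piecesVolume,
    Measure.sum_apply _ MeasurableSet.univ, tsum_fintype, Fin.sum_univ_two, hpiece, hpiece,
    ← ENNReal.ofReal_add (blochWigner_nonneg (M.shape_im_pos 0))
      (blochWigner_nonneg (M.shape_im_pos 1)), ENNReal.toReal_ofReal]
  exact add_nonneg (blochWigner_nonneg (M.shape_im_pos 0)) (blochWigner_nonneg (M.shape_im_pos 1))

/-- The four corners in the first tetrahedron all carry the parameter `z 0`, with signs that cancel.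
-/
theorem meridianHolonomy_eq (z : Fin 2 → ℂ) : meridianHolonomy z = 2 * logRatio (z 1) := by
  simp [meridianHolonomy, meridian, edgeParam, logRatio]
  ring

theorem edgeHolonomy_zero (z : Fin 2 → ℂ) : edgeHolonomy z 0 =
    (Complex.log (z 0) + 2 * Complex.log (1 - 1 / z 0)) +
      (Complex.log (z 1) + 2 * Complex.log (1 - 1 / z 1)) := by
  simp [edgeHolonomy, Fin.sum_univ_four, latticeVertex, edgeSlopes, edgeParam, funext_iff]
  ring

theorem edgeHolonomy_one (z : Fin 2 → ℂ) : edgeHolonomy z 1 =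
    (Complex.log (z 0) + 2 * Complex.log (1 / (1 - z 0))) +
      (Complex.log (z 1) + 2 * Complex.log (1 / (1 - z 1))) := by
  simp [edgeHolonomy, Fin.sum_univ_four, latticeVertex, edgeSlopes, edgeParam, funext_iff]
  ring

/-- As `log z + 2 log z'' = πi + logRatio z` and `log z + 2 log z' = πi - logRatio z`, the two edge
equations are equivalent. -/
theorem edgeHolonomy_eq_iff {z : Fin 2 → ℂ} (hz : ∀ i, 0 < (z i).im) :
    (∀ e, edgeHolonomy z e = 2 * Real.pi * Complex.I) ↔ logRatio (z 0) = -logRatio (z 1) := by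
  have h0 := log_add_log_add_log (hz 0)
  have h1 := log_add_log_add_log (hz 1)
  rw [Fin.forall_fin_two, edgeHolonomy_zero, edgeHolonomy_one]
  simp only [logRatio]
  constructor
  · rintro ⟨h, -⟩
    linear_combination h - h0 - h1
  · intro h
    constructor
    · linear_combination h + h0 + h1
    · linear_combination -h + h0 + h1

theorem neg_mem_Ioo_neg_pi_pi {η : ℝ} (hη : η ∈ Set.Ioo (-Real.pi) Real.pi) :
    -η ∈ Set.Ioo (-Real.pi) Real.pi :=
  ⟨neg_lt_neg hη.2, by linarith [hη.1]⟩

/-- The cone structure with shape parameters `z₂(η)`, `z₁(η)`. -/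
noncomputable def coneStructureOfMem {η : ℝ} (hη : η ∈ Set.Ioo (-Real.pi) Real.pi) :
    ConeStructure (2 * |η|) where
  shape := ![shape₁ (-η), shape₁ η]
  shape_im_pos := Fin.forall_fin_two.2
    ⟨shape₁_im_pos (neg_mem_Ioo_neg_pi_pi hη), shape₁_im_pos hη⟩
  edge_eq := by
    rw [edgeHolonomy_eq_iff (Fin.forall_fin_two.2
      ⟨shape₁_im_pos (neg_mem_Ioo_neg_pi_pi hη), shape₁_im_pos hη⟩)]
    simp [logRatio_shape₁ hη, logRatio_shape₁ (neg_mem_Ioo_neg_pi_pi hη)]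
  meridian_eq := by
    rw [meridianHolonomy_eq]
    simp only [Matrix.cons_val, logRatio_shape₁ hη]
    -- The sign of `η` is absorbed by the choice of orientation of the meridian.
    rcases abs_choice η with h | h <;> rw [h]
    · left; push_cast; ring
    · right; push_cast; ring

theorem ConeStructure.exists_shape_eq {η : ℝ} (hη : η ∈ Set.Ioo (-Real.pi) Real.pi)
    (M : ConeStructure (2 * |η|)) :
    (M.shape 0 = shape₁ η ∧ M.shape 1 = shape₁ (-η)) ∨
      (M.shape 0 = shape₁ (-η) ∧ M.shape 1 = shape₁ η) := by
  have he := (edgeHolonomy_eq_iff M.shape_im_pos).1 M.edge_eq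
  have hm : logRatio (M.shape 1) = η * Complex.I ∨
      logRatio (M.shape 1) = (-η : ℝ) * Complex.I := by
    have h := M.meridian_eq
    rw [meridianHolonomy_eq] at h
    generalize logRatio (M.shape 1) = l at *
    rcases abs_choice η with h' | h' <;> rw [h'] at h <;> push_cast at h ⊢ <;>
      rcases h with h | h
    · left; linear_combination h / 2
    · right; linear_combination h / 2
    · right; linear_combination h / 2
    · left; linear_combination h / 2
  have hη' := neg_mem_Ioo_neg_pi_pi hη
  rcases hm with h | h
  · refine Or.inr ⟨eq_shape₁_of_logRatio_eq (M.shape_im_pos 0) hη' ?_,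
      eq_shape₁_of_logRatio_eq (M.shape_im_pos 1) hη h⟩
    rw [he, h]; push_cast; ring
  · refine Or.inl ⟨eq_shape₁_of_logRatio_eq (M.shape_im_pos 0) hη ?_,
      eq_shape₁_of_logRatio_eq (M.shape_im_pos 1) hη' h⟩
    rw [he, h]; push_cast; ring

theorem potential₁_identity (η x y : ℝ)
    (h : ∀ r : ℝ, 1 ≤ r → -Complex.exp (-2 * (x + y * Complex.I) * Complex.I) ≠ (r : ℂ)) :
    DifferentiableAt ℝ (fun t : ℝ => (potential₁ η (x + t * Complex.I)).im) y ∧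
      (potential₁ η (x + y * Complex.I)).im =
        blochWigner (-Complex.exp (-2 * (x + y * Complex.I) * Complex.I)) +
          y * deriv (fun t : ℝ => (potential₁ η (x + t * Complex.I)).im) y := by
  have hd := hasDerivAt_im_potential₁ η x y (one_sub_mem_slitPlane_of_forall_ne h)
  exact ⟨hd.differentiableAt, by rw [hd.deriv]; exact im_potential₁_eq η x y⟩

end Volume

theorem mainTheorem4 :
    (∀ η ∈ Set.Ioo (-Real.pi) Real.pi, ∀ x y : ℝ,
      (∀ r : ℝ, 1 ≤ r → -Complex.exp (-2 * (x + y * Complex.I) * Complex.I) ≠ (r : ℂ)) →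
        (DifferentiableAt ℝ (fun t : ℝ => (potential₁ η (x + t * Complex.I)).im) y ∧
          (potential₁ η (x + y * Complex.I)).im =
            blochWigner (-Complex.exp (-2 * (x + y * Complex.I) * Complex.I)) +
              y * deriv (fun t : ℝ => (potential₁ η (x + t * Complex.I)).im) y) ∧
        (DifferentiableAt ℝ (fun t : ℝ => (potential₂ η (x + t * Complex.I)).im) y ∧
          (potential₂ η (x + y * Complex.I)).im =
            blochWigner (-Complex.exp (-2 * (x + y * Complex.I) * Complex.I)) +
              y * deriv (fun t : ℝ => (potential₂ η (x + t * Complex.I)).im) y)) ∧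
    (∃ α₁ α₂ : ℝ → ℂ, IsCriticalBranch shape₁ α₁ ∧ IsCriticalBranch shape₂ α₂) ∧
    (∀ α₁ α₂ : ℝ → ℂ, IsCriticalBranch shape₁ α₁ → IsCriticalBranch shape₂ α₂ →
      ∀ η ∈ Set.Ioo (-Real.pi) Real.pi,
        HasDerivAt (potential₁ η) 0 (α₁ η) ∧ HasDerivAt (potential₂ η) 0 (α₂ η) ∧
        Nonempty (ConeStructure (2 * |η|)) ∧
        ∀ M : ConeStructure (2 * |η|),
          (potential₁ η (α₁ η) + potential₂ η (α₂ η)).im = M.volume) := by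
  refine ⟨fun η _ x y h => ?_, ⟨_, _, isCriticalBranch_logBranch,
    isCriticalBranch_logBranch.comp_neg⟩, fun α₁ α₂ h₁ h₂ η hη => ?_⟩
  · rw [potential₂_eq]
    exact ⟨potential₁_identity η x y h, potential₁_identity (-η) x y h⟩
  · have hη' := neg_mem_Ioo_neg_pi_pi hη
    have e₁ := h₁.eq_of_eq isCriticalBranch_logBranch hη
    have e₂ := h₂.eq_of_eq isCriticalBranch_logBranch.comp_neg hη
    rw [e₁, e₂, potential₂_eq]
    refine ⟨hasDerivAt_potential₁_logBranch hη, hasDerivAt_potential₁_logBranch hη',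
      ⟨coneStructureOfMem hη⟩, fun M => ?_⟩
    rw [M.volume_eq, Complex.add_im, im_potential₁_logBranch hη, im_potential₁_logBranch hη']
    rcases M.exists_shape_eq hη with ⟨h, h'⟩ | ⟨h, h'⟩ <;> rw [h, h']
    exact add_comm _ _
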